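/- Let $n\ge 1$ and $F(\mathbf x)=f(\mathbf x)+h(\mathbf x)$ on $\mathbb R^n$ (Euclidean norm), where $f:\mathbb R^n\to\mathbb R$ is convex and differentiable, $h(\mathbf x)=\sum_{i=1}^n h_i(\mathbf x_i)$ with each $h_i:\mathbb R\to\mathbb R$ convex, and $|\nabla_i f(\mathbf x)-\nabla_i f(\mathbf y)|\le L_c|\mathbf x_i-\mathbf y_i|$ for every $i$ and all $\mathbf x,\mathbf y$ that differ only in the $i$-th coordinate. Let $\mathbf x^*$ be a minimizer of $F$. Algorithm AASCD with step size $\gamma>0$ and parameters $\theta^k$: start from $\mathbf x^0=\mathbf z^0=\mathbf 0$, and put $a^k=\theta^k(1-\theta^{k-1})/\theta^{k-1}$ $(k\ge1)$, $b(l,k)=\prod_{i=l}^k a^i$. At iteration $k=0,1,2,\dots$, with $\mathbf y^k=(1-\theta^k)\mathbf x^k+\theta^k\mathbf z^k$, a state with index $j(k)$ is read, where $\max(0,k-\tau)\le j(k)\le k$, and $$\mathbf w^{j(k)}=\mathbf y^{j(k)}+\Big(\sum_{i=j(k)+1}^{k} b(j(k)+1,i)\Big)\big(\mathbf y^{j(k)}-\mathbf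 x^{j(k)}\big);$$ an index $i_k$ is drawn uniformly from $\{1,\dots,n\}$, independently of $i_0,\dots,i_{k-1}$ and $j(0),\dots,j(k)$ (the read indices may be deterministic or random); then $$\delta^k=\arg\min_{\delta\in\mathbb R}\; h_{i_k}(\mathbf z^k_{i_k}+\delta)+\nabla_{i_k}f(\mathbf w^{j(k)})\,\delta+\frac{n\theta^k}{2\gamma}\delta^2,$$ $\mathbf z^{k+1}_{i_k}=\mathbf z^k_{i_k}+\delta^k$ with the other coordinates unchanged, and $\mathbf x^{k+1}=(1-\theta^k)\mathbf x^k+n\theta^k\mathbf z^{k+1}-(n-1)\theta^k\mathbf z^k$. Assume $\tau\le\sqrt n$. Then the following hold, and the expectations in them exist and are finite. (1) If $\theta^k=\frac{2}{2n+k}$ (so that $\theta^{-1}=\frac{2}{2n-1}$) and $2\gamma L_c+\left(1+\frac1n\right)\gamma L_c\left(\frac{\tau^2+\tau}{n}+2\tau\right)^2\le 1$, then for every $K\ge0$ $$\frac{\mathbb E[F(\mathbf x^{K+1})]-F(\mathbf x^*)}{(\theta^K)^2}+\frac{n^2}{2\gamma}\mathbb E\|\mathbf z^{K+1}-\mathbf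 x^*\|^2\le\frac{F(\mathbf x^0)-F(\mathbf x^*)}{(\theta^{-1})^2}+\frac{n^2}{2\gamma}\|\mathbf z^0-\mathbf x^*\|^2 .$$ (2) If $h$ is strongly convex with modulus $\mu$, $0<\mu\le L_c$, if $2\gamma L_c+\left(\frac34+\frac{3}{8n}\right)\gamma L_c\left(\frac{\tau^2+\tau}{n}+2\tau\right)^2\le1$, and if $\theta^k=\theta=\frac{-\gamma\mu+\sqrt{\gamma^2\mu^2+4\gamma\mu}}{2n}$ for all $k$, then for every $K\ge0$ $$\mathbb E[F(\mathbf x^{K+1})]-F(\mathbf x^*)\le(1-\theta)^{K+1}\big(F(\mathbf x^0)-F(\mathbf x^*)\big)+(1-\theta)^{K+1}\,\frac{n^2\theta^2+n\theta\mu\gamma}{2\gamma}\,\|\mathbf z^0-\mathbf x^*\|^2 .$$ -/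

import Mathlib

open MeasureTheory ProbabilityTheory

noncomputable section

namespace AASCD

/-- The separable function `h(x) = ∑ i, h i (x i)`. -/
def separable {n : ℕ} (h : Fin n → ℝ → ℝ) (x : EuclideanSpace ℝ (Fin n)) : ℝ :=
  ∑ i, h i (x i)

/-- The composite objective `F = f + h`, with `h` separable. -/
def objective {n : ℕ} (f : EuclideanSpace ℝ (Fin n) → ℝ) (h : Fin n → ℝ → ℝ)
    (x : EuclideanSpace ℝ (Fin n)) : ℝ :=
  f x + separable h x

/-- `∇f` is coordinate Lipschitz with constant `L`: if `x` and `y` differ at most in the `i`-th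
coordinate, then `|∇ᵢ f(x) - ∇ᵢ f(y)| ≤ L |xᵢ - yᵢ|`. -/
def CoordLipschitzGradient {n : ℕ} (f : EuclideanSpace ℝ (Fin n) → ℝ) (L : ℝ) : Prop :=
  ∀ (i : Fin n) (x y : EuclideanSpace ℝ (Fin n)), (∀ l, l ≠ i → x l = y l) →
    |gradient f x i - gradient f y i| ≤ L * |x i - y i|

/-- The one-step momentum coefficient `aᵏ = θᵏ (1 - θᵏ⁻¹) / θᵏ⁻¹`, used for `k ≥ 1` only. -/
def momentum (θ : ℕ → ℝ) (k : ℕ) : ℝ :=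
  θ k * (1 - θ (k - 1)) / θ (k - 1)

/-- The product `b(l, k) = aˡ aˡ⁺¹ ⋯ aᵏ`. -/
def momentumProd (θ : ℕ → ℝ) (l k : ℕ) : ℝ :=
  ∏ i ∈ Finset.Icc l k, momentum θ i

/-- The sequences `x, y, z, w` form a run of accelerated asynchronous stochastic coordinate
descent on `f + ∑ i, h i`, with step size `γ` and parameters `θᵏ`, when coordinate `idx k` is
updated at iteration `k` and the state read at iteration `k` is the one with index `j k`. -/
structure IsRun {n : ℕ} (f : EuclideanSpace ℝ (Fin n) → ℝ) (h : Fin n → ℝ → ℝ)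
    (γ : ℝ) (θ : ℕ → ℝ) (idx : ℕ → Fin n) (j : ℕ → ℕ)
    (x y z w : ℕ → EuclideanSpace ℝ (Fin n)) : Prop where
  x_zero : x 0 = 0
  z_zero : z 0 = 0
  /-- The extrapolation point. -/
  y_eq : ∀ k, y k = (1 - θ k) • x k + θ k • z k
  /-- The delayed extrapolation point with momentum compensation. -/
  w_eq : ∀ k, w k = y (j k) +
    (∑ i ∈ Finset.Icc (j k + 1) k, momentumProd θ (j k + 1) i) • (y (j k) - x (j k))
  /-- The proximal step on coordinate `idx k`; the other coordinates of `z` are unchanged. -/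
  z_step : ∀ k, ∃ δ : ℝ,
    IsMinOn (fun d : ℝ => h (idx k) (z k (idx k) + d) + gradient f (w k) (idx k) * d
      + n * θ k / (2 * γ) * d ^ 2) Set.univ δ ∧
    z (k + 1) = z k + EuclideanSpace.single (idx k) δ
  x_step : ∀ k, x (k + 1) =
    (1 - θ k) • x k + (n * θ k) • z (k + 1) - ((n - 1) * θ k) • z k

/-- Random coordinates `idx k` and (possibly random) read indices `j k`: the delay is at most `τ`,
and `idx k` is uniform on the `n` coordinates and independent of everything that happened
before it is drawn, i.e. of `idx 0, …, idx (k-1)` and `j 0, …, j k`. Every deterministic sequence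
of read indices with delay at most `τ` is allowed, with independent uniform coordinates. -/
structure IsSampling {n : ℕ} {Ω : Type*} [MeasurableSpace Ω] (P : Measure Ω) (τ : ℕ)
    (idx : ℕ → Ω → Fin n) (j : ℕ → Ω → ℕ) : Prop where
  measurable_idx : ∀ k, Measurable (idx k)
  measurable_j : ∀ k, Measurable (j k)
  delay : ∀ k ω, j k ω ≤ k ∧ k ≤ j k ω + τ
  uniform : ∀ k i, P.real {ω | idx k ω = i} = 1 / n
  indep : ∀ k, IndepFun (idx k)
    (fun ω => ((fun l : Fin k => idx l ω), (fun l : Fin (k + 1) => j l ω))) P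

/-- The parameters `θᵏ = 2 / (2n + k)` (for integers `k ≥ -1`). -/
def thetaNC (n : ℕ) (k : ℤ) : ℝ :=
  2 / (2 * n + k)

/-- The constant parameter `θ = (-γμ + √(γ²μ² + 4γμ)) / (2n)`. -/
def thetaSC (n : ℕ) (γ μ : ℝ) : ℝ :=
  (-(γ * μ) + Real.sqrt (γ ^ 2 * μ ^ 2 + 4 * (γ * μ))) / (2 * n)

end AASCD

end

/-!
The proof tracks the potential `Λₖ (E f(xᵏ) + E ĥₖ - F(x*) + Uₖ E ‖zᵏ - x*‖²)`. Here `ĥₖ`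
(`separableBound`) is the upper bound of `h(xᵏ)` obtained by writing `xᵏ` as a convex combination of
`z⁰, …, zᵏ`; unlike `h(xᵏ)`, it obeys an affine recursion.

For one iteration, with the gradient read at an arbitrary point `w`, averaging over the drawn
coordinate makes the potential contract, up to an error `L ‖yᵏ - w‖₁²`, and leaves a gain
`(1/(2γ) - L) E ‖xᵏ⁺¹ - yᵏ‖²` (`one_step`). The `ℓ¹` norm appears because, for a convex function,
the coordinate Lipschitz condition already implies that every `∇ᵢ f` is `L`-Lipschitz in the `ℓ¹`
norm (`CoordLipschitzGradient.lipschitz_l1norm`), a consequence of cocoercivity.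

The momentum compensation in the definition of `w` cancels the part of `yᵏ - w` that comes from the
momentum at the time of the read. What remains is a combination of the last `τ` steps
`xⁱ⁺¹ - yⁱ`, the step made `d` iterations ago having a coefficient of at most `1 + d/n`
(`IsRun.l1norm_y_sub_w_sq_le`). With `S` the sum of these coefficients (`delayTotal`), the errors
that a step causes later cost at most `L S² ρ` times its square, where `ρ` bounds the growth of `Λ`
over `τ` iterations, and the condition on `γ` says that the gain pays for this
(`le_of_delayed_descent`). The assumption `τ ≤ √n` serves to bound `ρ`.

A run is determined by the drawn coordinates and the read indices (`IsRun.eq_of_eq`), so every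
quantity of iteration `k` takes finitely many values. This gives integrability, and it reduces the
conditional expectation given the past to an average over the coordinate
(`IsSampling.integral_idx_eq`). The theorem follows from `expected_potential_le` with
`Λₖ = 1 / (θᵏ⁻¹)²` in the first part and `Λₖ = (1 - θ)⁻ᵏ` in the second.
-/

namespace AASCD

/-! ### Convex functions with coordinate Lipschitz gradient -/

/-- The `ℓ¹` norm of a vector of Euclidean space. -/
def l1norm {n : ℕ} (v : EuclideanSpace ℝ (Fin n)) : ℝ :=
  ∑ i, |v i|

lemma l1norm_nonneg {n : ℕ} (v : EuclideanSpace ℝ (Fin n)) : 0 ≤ l1norm v :=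
  Finset.sum_nonneg fun _ _ => abs_nonneg _

lemma l1norm_zero {n : ℕ} : l1norm (0 : EuclideanSpace ℝ (Fin n)) = 0 := by
  simp [l1norm]

lemma l1norm_add_le {n : ℕ} (u v : EuclideanSpace ℝ (Fin n)) :
    l1norm (u + v) ≤ l1norm u + l1norm v := by
  unfold l1norm
  rw [← Finset.sum_add_distrib]
  exact Finset.sum_le_sum fun i _ => abs_add_le _ _

lemma l1norm_smul {n : ℕ} (c : ℝ) (v : EuclideanSpace ℝ (Fin n)) :
    l1norm (c • v) = |c| * l1norm v := by
  simp [l1norm, Finset.mul_sum, abs_mul]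

lemma l1norm_single {n : ℕ} (i : Fin n) (s : ℝ) :
    l1norm (EuclideanSpace.single i s) = |s| := by
  unfold l1norm
  rw [Finset.sum_eq_single i]
  · simp
  · intro l _ hl
    simp [hl]
  · simp

lemma sum_mul_single {n : ℕ} (a : Fin n → ℝ) (i : Fin n) (s : ℝ) :
    ∑ l, a l * (EuclideanSpace.single i s : EuclideanSpace ℝ (Fin n)) l = a i * s := by
  rw [Finset.sum_eq_single i]
  · simp
  · intro l _ hl
    simp [hl]
  · simp

lemma hasDerivAt_line {n : ℕ} {f : EuclideanSpace ℝ (Fin n) → ℝ} (hf : Differentiable ℝ f)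
    (x v : EuclideanSpace ℝ (Fin n)) (t : ℝ) :
    HasDerivAt (fun t : ℝ => f (x + t • v)) (∑ i, gradient f (x + t • v) i * v i) t := by
  have h1 : HasDerivAt (fun t : ℝ => x + t • v) v t := by
    simpa using ((hasDerivAt_id t).smul_const v).const_add x
  have h2 := ((hf (x + t • v)).hasGradientAt.hasFDerivAt).comp_hasDerivAt t h1
  refine HasDerivAt.congr_deriv h2 ?_
  rw [InnerProductSpace.toDual_apply_apply, PiLp.inner_apply]
  exact Finset.sum_congr rfl fun i _ => by simp [mul_comm]

/-- The first-order condition for convexity, in coordinates. -/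
lemma gradient_inequality {n : ℕ} {f : EuclideanSpace ℝ (Fin n) → ℝ}
    (hf : ConvexOn ℝ Set.univ f) (hd : Differentiable ℝ f) (w v : EuclideanSpace ℝ (Fin n)) :
    f w + ∑ i, gradient f w i * v i ≤ f (w + v) := by
  have hc : ConvexOn ℝ Set.univ (fun t : ℝ => f (w + t • v)) := by
    refine ⟨convex_univ, fun a _ b _ p q hp hq hpq => ?_⟩
    have := hf.2 (Set.mem_univ (w + a • v)) (Set.mem_univ (w + b • v)) hp hq hpq
    convert this using 2
    obtain rfl : p = 1 - q := by linarith
    simp only [smul_eq_mul]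
    module
  have h := hc.le_slope_of_hasDerivAt (Set.mem_univ 0) (Set.mem_univ 1) zero_lt_one
    (hasDerivAt_line hd w v 0)
  simp [slope_def_field] at h
  linarith

/-- The descent lemma in one variable: if the derivative grows at most at rate `M`, the function
lies below its quadratic model. -/
lemma descent_of_deriv_le {φ φ' : ℝ → ℝ} {M : ℝ} (hφ : ∀ t, HasDerivAt φ (φ' t) t)
    (hM : ∀ t, 0 ≤ t → φ' t - φ' 0 ≤ M * t) : φ 1 ≤ φ 0 + φ' 0 + M / 2 := by
  have hd : ∀ t, HasDerivAt (fun t => φ t - φ' 0 * t - M / 2 * t ^ 2)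
      (φ' t - φ' 0 - M * t) t := by
    intro t
    have h1 := ((hφ t).sub ((hasDerivAt_id t).const_mul (φ' 0))).sub
      ((hasDerivAt_pow 2 t).const_mul (M / 2))
    refine HasDerivAt.congr_deriv h1 ?_
    push_cast
    ring
  have ha : AntitoneOn (fun t => φ t - φ' 0 * t - M / 2 * t ^ 2) (Set.Ici 0) := by
    refine antitoneOn_of_deriv_nonpos (convex_Ici 0)
      (fun t _ => (hd t).continuousAt.continuousWithinAt)
      (fun t _ => (hd t).differentiableAt.differentiableWithinAt) fun t ht => ?_
    rw [(hd t).deriv]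
    have : 0 < t := by simpa using ht
    linarith [hM t this.le]
  have := ha (Set.mem_Ici.2 le_rfl) (Set.mem_Ici.2 zero_le_one) zero_le_one
  norm_num at this
  linarith

lemma CoordLipschitzGradient.nonneg {n : ℕ} (hn : 1 ≤ n) {f : EuclideanSpace ℝ (Fin n) → ℝ}
    {L : ℝ} (hL : CoordLipschitzGradient f L) : 0 ≤ L := by
  have h := hL ⟨0, hn⟩ (EuclideanSpace.single ⟨0, hn⟩ 1) 0 (fun l hl => by simp [hl])
  simpa using (abs_nonneg _).trans h

/-- Quadratic upper bound along a coordinate. -/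
lemma CoordLipschitzGradient.descent_single {n : ℕ} {f : EuclideanSpace ℝ (Fin n) → ℝ}
    {L : ℝ} (hL : CoordLipschitzGradient f L) (hd : Differentiable ℝ f)
    (x : EuclideanSpace ℝ (Fin n)) (i : Fin n) (s : ℝ) :
    f (x + EuclideanSpace.single i s) ≤ f x + gradient f x i * s + L / 2 * s ^ 2 := by
  have h := descent_of_deriv_le (M := L * s ^ 2)
    (hasDerivAt_line hd x (EuclideanSpace.single i s)) ?_
  · simp only [zero_smul, add_zero, one_smul, sum_mul_single] at h
    linarith
  · intro t ht
    simp only [zero_smul, add_zero, sum_mul_single]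
    have h1 := hL i (x + t • EuclideanSpace.single i s) x (fun l hl => by simp [hl])
    have h2 : |t * s| = t * |s| := by rw [abs_mul, abs_of_nonneg ht]
    simp only [PiLp.add_apply, PiLp.smul_apply, PiLp.single_apply, if_true, smul_eq_mul,
      add_sub_cancel_left, h2] at h1
    calc _ = (gradient f (x + t • EuclideanSpace.single i s) i - gradient f x i) * s := by ring
      _ ≤ |gradient f (x + t • EuclideanSpace.single i s) i - gradient f x i| * |s| := by
        rw [← abs_mul]; exact le_abs_self _
      _ ≤ L * (t * |s|) * |s| := by gcongr
      _ = L * s ^ 2 * t := by rw [← sq_abs s]; ring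

/-- Cocoercivity along a coordinate: minimizing `u ↦ f u - ⟪∇f x, u⟫` from `y` along one
coordinate, and symmetrically, gives a family of bounds in the length `s` of the step. -/
lemma CoordLipschitzGradient.cocoercive {n : ℕ} {f : EuclideanSpace ℝ (Fin n) → ℝ}
    {L : ℝ} (hL : CoordLipschitzGradient f L) (hf : ConvexOn ℝ Set.univ f)
    (hd : Differentiable ℝ f) (x y : EuclideanSpace ℝ (Fin n)) (i : Fin n) (s : ℝ) :
    0 ≤ ∑ l, (gradient f y l - gradient f x l) * (y l - x l)
      + 2 * (gradient f y i - gradient f x i) * s + L * s ^ 2 := by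
  have key : ∀ (x y : EuclideanSpace ℝ (Fin n)) (s : ℝ),
      f x + ∑ l, gradient f x l * (y l - x l) + gradient f x i * s
        ≤ f y + gradient f y i * s + L / 2 * s ^ 2 := by
    intro x y s
    have h1 := gradient_inequality hf hd x ((y - x) + EuclideanSpace.single i s)
    have h2 := hL.descent_single hd y i s
    have h3 : ∑ l, gradient f x l
          * ((y - x) + EuclideanSpace.single i s : EuclideanSpace ℝ (Fin n)) l
        = ∑ l, gradient f x l * (y l - x l) + gradient f x i * s := by
      rw [← sum_mul_single (fun l => gradient f x l) i s, ← Finset.sum_add_distrib]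
      refine Finset.sum_congr rfl fun l _ => ?_
      simp only [PiLp.add_apply, PiLp.sub_apply]
      ring
    rw [h3, show x + (y - x + EuclideanSpace.single i s) = y + EuclideanSpace.single i s by
      abel] at h1
    linarith
  have h1 := key x y s
  have h2 := key y x (-s)
  have h3 : ∑ l, (gradient f y l - gradient f x l) * (y l - x l)
      = - ∑ l, gradient f x l * (y l - x l) - ∑ l, gradient f y l * (x l - y l) := by
    rw [← Finset.sum_neg_distrib, ← Finset.sum_sub_distrib]
    exact Finset.sum_congr rfl fun l _ => by ring
  rw [h3]
  linarith

lemma CoordLipschitzGradient.lipschitz_l1norm_of_pos {n : ℕ} {f : EuclideanSpace ℝ (Fin n) → ℝ}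
    {L : ℝ} (hL : CoordLipschitzGradient f L) (hpos : 0 < L) (hf : ConvexOn ℝ Set.univ f)
    (hd : Differentiable ℝ f) (x y : EuclideanSpace ℝ (Fin n)) (i : Fin n) :
    |gradient f y i - gradient f x i| ≤ L * l1norm (y - x) := by
  -- It suffices to bound the largest coordinate of the difference of the gradients.
  obtain ⟨m, -, hm⟩ := Finset.exists_max_image Finset.univ
    (fun l => |gradient f y l - gradient f x l|) ⟨i, Finset.mem_univ i⟩
  refine (hm i (Finset.mem_univ i)).trans ?_
  have h1 := hL.cocoercive hf hd x y m (-(gradient f y m - gradient f x m) / L)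
  have h2 : ∑ l, (gradient f y l - gradient f x l) * (y l - x l)
      ≤ |gradient f y m - gradient f x m| * l1norm (y - x) := by
    unfold l1norm
    rw [Finset.mul_sum]
    refine Finset.sum_le_sum fun l _ => (le_abs_self _).trans ?_
    rw [abs_mul]
    exact mul_le_mul_of_nonneg_right (hm l (Finset.mem_univ l)) (abs_nonneg _)
  set g := gradient f y m - gradient f x m
  have h3 : 2 * g * (-g / L) + L * (-g / L) ^ 2 = -(|g| ^ 2 / L) := by
    rw [sq_abs]; field_simp; ring
  have h4 : |g| ^ 2 / L ≤ |g| * l1norm (y - x) := by linarith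
  rw [div_le_iff₀ hpos] at h4
  rcases (abs_nonneg g).eq_or_lt with h0 | h0
  · rw [← h0]; exact mul_nonneg hpos.le (l1norm_nonneg _)
  · nlinarith

/-- For a convex function, Lipschitz continuity of each `∇ᵢ f` in its own coordinate implies
Lipschitz continuity of all of `∇f`, with the same constant, from the `ℓ¹` to the `ℓ^∞` norm. -/
lemma CoordLipschitzGradient.lipschitz_l1norm {n : ℕ} {f : EuclideanSpace ℝ (Fin n) → ℝ}
    {L : ℝ} (hL : CoordLipschitzGradient f L) (hf : ConvexOn ℝ Set.univ f)
    (hd : Differentiable ℝ f) (x y : EuclideanSpace ℝ (Fin n)) (i : Fin n) :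
    |gradient f y i - gradient f x i| ≤ L * l1norm (y - x) := by
  have h0 : 0 ≤ L := hL.nonneg (Nat.one_le_iff_ne_zero.2 fun h => (h ▸ i).elim0)
  refine le_of_forall_pos_le_add fun ε hε => ?_
  have hb : 0 < l1norm (y - x) + 1 := by linarith [l1norm_nonneg (y - x)]
  -- Enlarging the constant makes it positive, at an arbitrarily small cost.
  have hL' : CoordLipschitzGradient f (L + ε / (l1norm (y - x) + 1)) := fun i a b hab =>
    (hL i a b hab).trans (mul_le_mul_of_nonneg_right (by linarith [div_pos hε hb]) (abs_nonneg _))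
  refine (hL'.lipschitz_l1norm_of_pos (by positivity) hf hd x y i).trans ?_
  rw [add_mul]
  gcongr
  rw [div_mul_eq_mul_div, div_le_iff₀ hb]
  nlinarith

/-- Quadratic upper bound in the `ℓ¹` norm. -/
lemma CoordLipschitzGradient.descent_l1norm {n : ℕ} {f : EuclideanSpace ℝ (Fin n) → ℝ}
    {L : ℝ} (hL : CoordLipschitzGradient f L) (hf : ConvexOn ℝ Set.univ f)
    (hd : Differentiable ℝ f) (w v : EuclideanSpace ℝ (Fin n)) :
    f (w + v) ≤ f w + ∑ i, gradient f w i * v i + L / 2 * l1norm v ^ 2 := by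
  have h := descent_of_deriv_le (M := L * l1norm v ^ 2) (hasDerivAt_line hd w v) ?_
  · simp only [zero_smul, add_zero, one_smul] at h
    linarith
  · intro t ht
    simp only [zero_smul, add_zero]
    rw [← Finset.sum_sub_distrib]
    calc _ ≤ ∑ i, L * (t * l1norm v) * |v i| := by
          refine Finset.sum_le_sum fun i _ => ?_
          have h1 := hL.lipschitz_l1norm hf hd w (w + t • v) i
          rw [add_sub_cancel_left, l1norm_smul, abs_of_nonneg ht] at h1
          rw [← sub_mul]
          refine (le_abs_self _).trans ?_
          rw [abs_mul]
          gcongr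
      _ = L * l1norm v ^ 2 * t := by
          rw [← Finset.mul_sum]
          change L * (t * l1norm v) * l1norm v = _
          ring

/-! ### The proximal coordinate step -/

/-- A minimizer of a strongly convex function beats every other point by a quadratic margin. -/
lemma add_sq_le_of_isMinOn {φ : ℝ → ℝ} {m p : ℝ} (hφ : StrongConvexOn Set.univ m φ)
    (hp : IsMinOn φ Set.univ p) (u : ℝ) : φ p + m / 2 * (u - p) ^ 2 ≤ φ u := by
  -- Compare `φ p` with the value at `(1 - t) p + t u`, divide by `t` and let `t → 0`.
  have key : ∀ t ∈ Set.Ioo (0 : ℝ) 1, φ p + (1 - t) * (m / 2 * (u - p) ^ 2) ≤ φ u := by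
    rintro t ⟨h0, h1⟩
    have ha := hφ.2 (Set.mem_univ p) (Set.mem_univ u) (sub_nonneg.2 h1.le) h0.le (by ring)
    have hb : φ p ≤ φ ((1 - t) • p + t • u) := hp (Set.mem_univ _)
    simp only [smul_eq_mul, Real.norm_eq_abs, sq_abs] at ha hb
    have hc : t * (φ p + (1 - t) * (m / 2 * (u - p) ^ 2)) ≤ t * φ u := by linarith
    exact le_of_mul_le_mul_left hc h0
  have hlim : Filter.Tendsto (fun t : ℝ => φ p + (1 - t) * (m / 2 * (u - p) ^ 2))
      (nhdsWithin 0 (Set.Ioi 0)) (nhds (φ p + (1 - 0) * (m / 2 * (u - p) ^ 2))) := by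
    refine Filter.Tendsto.mono_left (Continuous.tendsto ?_ 0) nhdsWithin_le_nhds
    fun_prop
  have := le_of_tendsto hlim
    (Filter.eventually_of_mem (Ioo_mem_nhdsGT zero_lt_one) fun t ht => key t ht)
  linarith

lemma strongConvexOn_prox {h : ℝ → ℝ} {μ : ℝ} (hh : StrongConvexOn Set.univ μ h) (g κ z : ℝ) :
    StrongConvexOn Set.univ (μ + 2 * κ) (fun d => h (z + d) + g * d + κ * d ^ 2) := by
  refine ⟨convex_univ, fun a _ b _ p q hp hq hpq => ?_⟩
  have := hh.2 (Set.mem_univ (z + a)) (Set.mem_univ (z + b)) hp hq hpq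
  obtain rfl : p = 1 - q := by linarith
  simp only [smul_eq_mul, Real.norm_eq_abs, sq_abs, add_sub_add_left_eq_sub] at this ⊢
  rw [show (1 - q) * (z + a) + q * (z + b) = z + ((1 - q) * a + q * b) by ring] at this
  linarith

/-- The proximal subproblem in one variable has a solution: a convex function on `ℝ` decreases at
most linearly, so the quadratic term makes the objective coercive. -/
lemma exists_isMinOn_prox {h : ℝ → ℝ} (hh : ConvexOn ℝ Set.univ h) (g : ℝ) {κ : ℝ} (hκ : 0 < κ)
    (z : ℝ) : ∃ δ, IsMinOn (fun d => h (z + d) + g * d + κ * d ^ 2) Set.univ δ := by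
  have hcont : Continuous h := continuousOn_univ.1 (hh.continuousOn isOpen_univ)
  have hφ : Continuous fun d => h (z + d) + g * d + κ * d ^ 2 := by fun_prop
  have hlin : ∀ s d : ℝ, 1 ≤ d → h z + d * (h (z + s) - h z) ≤ h (z + s * d) := by
    intro s d hd
    have hd0 : 0 < d := by linarith
    have h1 := hh.2 (Set.mem_univ z) (Set.mem_univ (z + s * d))
      (sub_nonneg.2 (inv_le_one_of_one_le₀ hd)) (inv_nonneg.2 hd0.le) (by ring)
    simp only [smul_eq_mul] at h1
    rw [show (1 - d⁻¹) * z + d⁻¹ * (z + s * d) = z + s by field_simp; ring] at h1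
    have h2 := mul_le_mul_of_nonneg_left h1 hd0.le
    have h3 : d * ((1 - d⁻¹) * h z + d⁻¹ * h (z + s * d)) = (d - 1) * h z + h (z + s * d) := by
      field_simp
    linarith
  have hco : ∀ᶠ d in Filter.cocompact ℝ,
      h (z + 0) + g * 0 + κ * 0 ^ 2 ≤ h (z + d) + g * d + κ * d ^ 2 := by
    rw [cocompact_eq_atBot_atTop, Filter.eventually_sup]
    constructor
    · filter_upwards [Filter.eventually_le_atBot (-1),
        Filter.eventually_le_atBot ((h (z + -1) - h z - g) / κ)] with d h1 h2
      have h3 := hlin (-1) (-d) (by linarith)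
      rw [le_div_iff₀ hκ] at h2
      rw [show -1 * -d = d by ring] at h3
      simp only [add_zero, mul_zero, ne_eq, OfNat.ofNat_ne_zero, not_false_eq_true, zero_pow]
      nlinarith
    · filter_upwards [Filter.eventually_ge_atTop 1,
        Filter.eventually_ge_atTop ((-(h (z + 1) - h z) - g) / κ)] with d h1 h2
      have h3 := hlin 1 d h1
      rw [div_le_iff₀ hκ] at h2
      rw [one_mul] at h3
      simp only [add_zero, mul_zero, ne_eq, OfNat.ofNat_ne_zero, not_false_eq_true, zero_pow]
      nlinarith
  obtain ⟨δ, hδ⟩ := hφ.exists_forall_le' 0 hco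
  exact ⟨δ, fun d _ => hδ d⟩

/-- The solution `δ` of the one-dimensional proximal subproblem
`min h (z + δ) + g δ + κ δ²`; it exists and is unique for convex `h` and `κ > 0`. -/
noncomputable def proxStep (h : ℝ → ℝ) (g κ z : ℝ) : ℝ :=
  Classical.epsilon fun δ => IsMinOn (fun d => h (z + d) + g * d + κ * d ^ 2) Set.univ δ

lemma isMinOn_proxStep {h : ℝ → ℝ} (hh : ConvexOn ℝ Set.univ h) (g : ℝ) {κ : ℝ} (hκ : 0 < κ)
    (z : ℝ) :
    IsMinOn (fun d => h (z + d) + g * d + κ * d ^ 2) Set.univ (proxStep h g κ z) :=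
  Classical.epsilon_spec (exists_isMinOn_prox hh g hκ z)

lemma eq_proxStep {h : ℝ → ℝ} (hh : ConvexOn ℝ Set.univ h) {g κ z δ : ℝ} (hκ : 0 < κ)
    (hδ : IsMinOn (fun d => h (z + d) + g * d + κ * d ^ 2) Set.univ δ) :
    δ = proxStep h g κ z := by
  have h1 := add_sq_le_of_isMinOn (strongConvexOn_prox (strongConvexOn_zero.2 hh) g κ z) hδ
    (proxStep h g κ z)
  have h2 := isMinOn_iff.1 (isMinOn_proxStep hh g hκ z) δ (Set.mem_univ δ)
  have h3 : κ * (proxStep h g κ z - δ) ^ 2 ≤ 0 := by linarith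
  have h4 : (proxStep h g κ z - δ) ^ 2 = 0 :=
    le_antisymm (nonpos_of_mul_nonpos_right h3 hκ) (sq_nonneg _)
  linarith [pow_eq_zero_iff (two_ne_zero) |>.1 h4]

lemma separable_add_single {n : ℕ} (h : Fin n → ℝ → ℝ) (z : EuclideanSpace ℝ (Fin n))
    (i : Fin n) (s : ℝ) :
    separable h (z + EuclideanSpace.single i s) = separable h z + (h i (z i + s) - h i (z i)) := by
  unfold separable
  rw [← sub_eq_iff_eq_add', ← Finset.sum_sub_distrib, Finset.sum_eq_single i]
  · simp
  · intro l _ hl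
    simp [hl]
  · simp

lemma norm_sq_eq_separable {n : ℕ} (v u : EuclideanSpace ℝ (Fin n)) :
    ‖v - u‖ ^ 2 = separable (fun i t => (t - u i) ^ 2) v := by
  simp [separable, EuclideanSpace.norm_sq_eq]

lemma convexOn_separable {n : ℕ} {h : Fin n → ℝ → ℝ} (hh : ∀ i, ConvexOn ℝ Set.univ (h i)) :
    ConvexOn ℝ Set.univ (separable h) := by
  refine ⟨convex_univ, fun a _ b _ p q hp hq hpq => ?_⟩
  unfold separable
  rw [smul_eq_mul, smul_eq_mul, Finset.mul_sum, Finset.mul_sum, ← Finset.sum_add_distrib]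
  refine Finset.sum_le_sum fun i _ => ?_
  have := (hh i).2 (Set.mem_univ (a i)) (Set.mem_univ (b i)) hp hq hpq
  simpa using this

/-- Strong convexity of a separable function passes to each of its summands. -/
lemma strongConvexOn_of_separable {n : ℕ} {h : Fin n → ℝ → ℝ} {μ : ℝ}
    (hh : StrongConvexOn Set.univ μ (separable h)) (i : Fin n) :
    StrongConvexOn Set.univ μ (h i) := by
  refine ⟨convex_univ, fun a _ b _ p q hp hq hpq => ?_⟩
  have key := hh.2 (Set.mem_univ (0 + EuclideanSpace.single i a))
    (Set.mem_univ (0 + EuclideanSpace.single i b)) hp hq hpq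
  have h1 : p • ((0 : EuclideanSpace ℝ (Fin n)) + EuclideanSpace.single i a)
      + q • (0 + EuclideanSpace.single i b) = 0 + EuclideanSpace.single i (p • a + q • b) := by
    ext l
    by_cases hl : l = i <;> simp [hl]
  have h2 : ‖((0 : EuclideanSpace ℝ (Fin n)) + EuclideanSpace.single i a)
      - (0 + EuclideanSpace.single i b)‖ = ‖a - b‖ := by
    rw [add_sub_add_left_eq_sub, show (EuclideanSpace.single i a : EuclideanSpace ℝ (Fin n))
      - EuclideanSpace.single i b = EuclideanSpace.single i (a - b) by
        ext l; by_cases hl : l = i <;> simp [hl], PiLp.norm_single]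
  rw [h1, h2, separable_add_single, separable_add_single, separable_add_single] at key
  obtain rfl : p = 1 - q := by linarith
  simp only [PiLp.zero_apply, zero_add, smul_eq_mul] at key ⊢
  linarith

/-- The decrease obtained from one proximal coordinate step, averaged over the coordinate. The
point `w` where the gradient is read is arbitrary; its distance to the extrapolation point
`(1 - θ) x + θ z` enters through the `ℓ¹` norm. -/
lemma one_step {n : ℕ} (hn : 1 ≤ n) {f : EuclideanSpace ℝ (Fin n) → ℝ} {h : Fin n → ℝ → ℝ}
    {L γ μ θ : ℝ} (hf : ConvexOn ℝ Set.univ f) (hd : Differentiable ℝ f)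
    (hL : CoordLipschitzGradient f L) (hh : ∀ i, StrongConvexOn Set.univ μ (h i)) (hγ : 0 < γ)
    (hθ : 0 < θ) (hθ1 : θ ≤ 1) (x y z w u : EuclideanSpace ℝ (Fin n)) (d : Fin n → ℝ)
    (hy : y = (1 - θ) • x + θ • z)
    (hmin : ∀ i, IsMinOn (fun s => h i (z i + s) + gradient f w i * s
      + n * θ / (2 * γ) * s ^ 2) Set.univ (d i)) :
    1 / n * ∑ i, (f (y + EuclideanSpace.single i (n * θ * d i))
        + (n * θ * separable h (z + EuclideanSpace.single i (d i))
          - (n - 1) * θ * separable h z)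
        + (n ^ 2 * θ ^ 2 / (2 * γ) + n * θ * μ / 2)
          * ‖z + EuclideanSpace.single i (d i) - u‖ ^ 2
        + (1 / (2 * γ) - L) * (n * θ * d i) ^ 2)
      ≤ (1 - θ) * f x + θ * objective f h u
        + (n ^ 2 * θ ^ 2 / (2 * γ) + (n - 1) * θ * μ / 2) * ‖z - u‖ ^ 2
        + L * l1norm (y - w) ^ 2 := by
  have hn0 : (0 : ℝ) < n := by exact_mod_cast hn
  have hL0 := hL.nonneg hn
  set W := l1norm (y - w) with hW
  have hW0 : 0 ≤ W := l1norm_nonneg _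
  set V := (n : ℝ) ^ 2 * θ ^ 2 / (2 * γ) + n * θ * μ / 2 with hV
  have hVn : V = n * θ * (n * θ / (2 * γ) + μ / 2) := by rw [hV]; ring
  have hcoord : ∀ i, f (y + EuclideanSpace.single i (n * θ * d i))
        + (n * θ * separable h (z + EuclideanSpace.single i (d i))
          - (n - 1) * θ * separable h z)
        + V * ‖z + EuclideanSpace.single i (d i) - u‖ ^ 2
        + (1 / (2 * γ) - L) * (n * θ * d i) ^ 2
      ≤ (f y + L / 2 * W ^ 2 + θ * separable h z + V * ‖z - u‖ ^ 2)
        + n * θ * (h i (u i) - h i (z i) + gradient f w i * (u i - z i)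
          - μ / 2 * (z i - u i) ^ 2) := by
    intro i
    have h1 := hL.descent_single hd y i (n * θ * d i)
    have h2 := hL.lipschitz_l1norm hf hd w y i
    have h3 : (gradient f y i - gradient f w i) * (n * θ * d i)
        ≤ L / 2 * W ^ 2 + L / 2 * (n * θ * d i) ^ 2 := by
      calc _ ≤ |gradient f y i - gradient f w i| * |n * θ * d i| := by
            rw [← abs_mul]; exact le_abs_self _
        _ ≤ L * W * |n * θ * d i| := by gcongr
        _ ≤ L / 2 * W ^ 2 + L / 2 * |n * θ * d i| ^ 2 := by
            nlinarith [mul_nonneg hL0 (sq_nonneg (W - |n * θ * d i|))]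
        _ = _ := by rw [sq_abs]
    have h4 := add_sq_le_of_isMinOn
      (strongConvexOn_prox (hh i) (gradient f w i) (n * θ / (2 * γ)) (z i)) (hmin i) (u i - z i)
    have h5 := mul_le_mul_of_nonneg_left h4 (mul_pos hn0 hθ).le
    rw [show z i + (u i - z i) = u i by ring] at h5
    rw [norm_sq_eq_separable, norm_sq_eq_separable, separable_add_single, separable_add_single,
      hVn]
    have h6 : 1 / (2 * γ) * (n * θ * d i) ^ 2 = n * θ * (n * θ / (2 * γ) * d i ^ 2) := by
      field_simp
    generalize n * θ / (2 * γ) = κ at *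
    linarith
  have hsum : ∑ i, (h i (u i) - h i (z i) + gradient f w i * (u i - z i)
        - μ / 2 * (z i - u i) ^ 2)
      = separable h u - separable h z + ∑ i, gradient f w i * (u i - z i)
        - μ / 2 * ‖z - u‖ ^ 2 := by
    rw [norm_sq_eq_separable]
    simp only [separable, Finset.sum_add_distrib, Finset.sum_sub_distrib, Finset.mul_sum]
  have h1 : 1 / (n : ℝ) * ∑ i, ((f y + L / 2 * W ^ 2 + θ * separable h z + V * ‖z - u‖ ^ 2)
        + n * θ * (h i (u i) - h i (z i) + gradient f w i * (u i - z i)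
          - μ / 2 * (z i - u i) ^ 2))
      = (f y + L / 2 * W ^ 2 + θ * separable h z + V * ‖z - u‖ ^ 2)
        + θ * (separable h u - separable h z + ∑ i, gradient f w i * (u i - z i)
          - μ / 2 * ‖z - u‖ ^ 2) := by
    rw [← hsum, Finset.sum_add_distrib, ← Finset.mul_sum, Finset.sum_const, Finset.card_univ,
      Fintype.card_fin, nsmul_eq_mul]
    field_simp
  refine (mul_le_mul_of_nonneg_left (Finset.sum_le_sum fun i _ => hcoord i)
    (by positivity)).trans ?_
  rw [h1]
  have h2 := hL.descent_l1norm hf hd w (y - w)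
  have h3 := gradient_inequality hf hd w (x - w)
  have h4 := gradient_inequality hf hd w (u - w)
  rw [add_sub_cancel] at h2 h3 h4
  have h5 : ∑ i, gradient f w i * (y - w) i + θ * ∑ i, gradient f w i * (u i - z i)
      = (1 - θ) * ∑ i, gradient f w i * (x - w) i + θ * ∑ i, gradient f w i * (u - w) i := by
    rw [Finset.mul_sum, Finset.mul_sum, Finset.mul_sum, ← Finset.sum_add_distrib,
      ← Finset.sum_add_distrib]
    refine Finset.sum_congr rfl fun i _ => ?_
    simp only [hy, PiLp.add_apply, PiLp.sub_apply, PiLp.smul_apply, smul_eq_mul]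
    ring
  have h6 := mul_le_mul_of_nonneg_left h3 (sub_nonneg.2 hθ1)
  have h7 := mul_le_mul_of_nonneg_left h4 hθ.le
  simp only [objective, hV]
  linarith

/-! ### Delayed reads along a run -/

/-- The weighted upper bound of `h (xᵏ)` by the values `h (zˡ)`, `l ≤ k`, that comes from writing
`xᵏ` as a convex combination of `z⁰, …, zᵏ`. -/
noncomputable def separableBound {n : ℕ} (h : Fin n → ℝ → ℝ) (θ : ℕ → ℝ)
    (z : ℕ → EuclideanSpace ℝ (Fin n)) : ℕ → ℝ
  | 0 => separable h (z 0)
  | k + 1 => (1 - θ k) * separableBound h θ z k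
      + (n * θ k * separable h (z (k + 1)) - (n - 1) * θ k * separable h (z k))

lemma exists_convex_combination {E : Type*} [AddCommGroup E] [Module ℝ E] {H : E → ℝ}
    (hH : ConvexOn ℝ Set.univ H) (u v : E) {α β : ℝ} (hα : 0 ≤ α) (hβ : 0 ≤ β) :
    ∃ c, (α + β) • c = α • u + β • v ∧ (α + β) * H c ≤ α * H u + β * H v := by
  rcases (add_nonneg hα hβ).eq_or_lt with h0 | h0
  · obtain rfl : α = 0 := by linarith
    obtain rfl : β = 0 := by linarith
    exact ⟨u, by simp, by simp⟩
  · refine ⟨(α / (α + β)) • u + (β / (α + β)) • v, ?_, ?_⟩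
    · rw [smul_add, smul_smul, smul_smul, mul_div_cancel₀ _ h0.ne', mul_div_cancel₀ _ h0.ne']
    · have := hH.2 (Set.mem_univ u) (Set.mem_univ v) (div_nonneg hα h0.le) (div_nonneg hβ h0.le)
        (by rw [← add_div, div_self h0.ne'])
      refine (mul_le_mul_of_nonneg_left this h0.le).trans_eq ?_
      simp only [smul_eq_mul]
      field_simp

namespace IsRun

variable {n : ℕ} {f : EuclideanSpace ℝ (Fin n) → ℝ} {h : Fin n → ℝ → ℝ} {γ : ℝ} {θ : ℕ → ℝ}
  {idx : ℕ → Fin n} {j : ℕ → ℕ} {x y z w : ℕ → EuclideanSpace ℝ (Fin n)}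

lemma y_sub_x (hr : IsRun f h γ θ idx j x y z w) (k : ℕ) : y k - x k = θ k • (z k - x k) := by
  rw [hr.y_eq]
  module

lemma x_succ_sub_y (hr : IsRun f h γ θ idx j x y z w) (k : ℕ) :
    x (k + 1) - y k = (n * θ k) • (z (k + 1) - z k) := by
  rw [hr.y_eq, hr.x_step]
  module

/-- The momentum `y - x` is multiplied by `aᵏ⁺¹` in each iteration, up to a multiple of the last
step; compensating the delay by these factors therefore leaves an error made of the steps only. -/
lemma y_sub_x_succ (hr : IsRun f h γ θ idx j x y z w) (hθ : ∀ k, 0 < θ k) (k : ℕ) :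
    y (k + 1) - x (k + 1) = momentum θ (k + 1) • (y k - x k)
      + (θ (k + 1) * (1 - n * θ k)) • (z (k + 1) - z k) := by
  have h1 : momentum θ (k + 1) * θ k = θ (k + 1) * (1 - θ k) := by
    rw [momentum, Nat.add_sub_cancel]
    field_simp [(hθ k).ne']
  rw [hr.y_sub_x, hr.y_sub_x, smul_smul, h1, hr.x_step]
  module

lemma l1norm_momentum_error_le (hr : IsRun f h γ θ idx j x y z w) (hn : 1 ≤ n)
    (hθ : ∀ k, 0 < θ k) (hθn : ∀ k, n * θ k ≤ 1) (hanti : ∀ k, θ (k + 1) ≤ θ k) (l k : ℕ)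
    (hlk : l ≤ k) :
    l1norm (y k - x k - momentumProd θ (l + 1) k • (y l - x l))
      ≤ 1 / n * ∑ i ∈ Finset.Ico l k, l1norm (x (i + 1) - y i) := by
  have hn0 : (0 : ℝ) < n := by exact_mod_cast hn
  have hn1 : (1 : ℝ) ≤ n := by exact_mod_cast hn
  induction k, hlk using Nat.le_induction with
  | base => simp [momentumProd, l1norm_zero]
  | succ k hk ih =>
    have hθ1 : θ k ≤ 1 := by nlinarith [hθn k, hθ k]
    have ha0 : 0 ≤ momentum θ (k + 1) := by
      rw [momentum, Nat.add_sub_cancel]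
      exact div_nonneg (mul_nonneg (hθ _).le (by linarith)) (hθ k).le
    have ha1 : momentum θ (k + 1) ≤ 1 := by
      rw [momentum, Nat.add_sub_cancel, div_le_one (hθ k)]
      nlinarith [hanti k, hθ k, hθ (k + 1)]
    have hp : momentumProd θ (l + 1) (k + 1) = momentum θ (k + 1) * momentumProd θ (l + 1) k := by
      rw [momentumProd, Finset.prod_Icc_succ_top (by omega), mul_comm, momentumProd]
    have hs : y (k + 1) - x (k + 1) - momentumProd θ (l + 1) (k + 1) • (y l - x l)
        = momentum θ (k + 1) • (y k - x k - momentumProd θ (l + 1) k • (y l - x l))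
          + (θ (k + 1) * (1 - n * θ k) / (n * θ k)) • (x (k + 1) - y k) := by
      rw [hr.y_sub_x_succ hθ, hr.x_succ_sub_y, hp, smul_smul _ (n * θ k),
        div_mul_cancel₀ _ (mul_pos hn0 (hθ k)).ne']
      module
    rw [hs, Finset.sum_Ico_succ_top hk, mul_add]
    refine (l1norm_add_le _ _).trans (add_le_add ?_ ?_)
    · rw [l1norm_smul, abs_of_nonneg ha0]
      exact (mul_le_of_le_one_left (l1norm_nonneg _) ha1).trans ih
    · have hc : θ (k + 1) * (1 - n * θ k) / (n * θ k) ≤ 1 / n := by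
        rw [div_le_div_iff₀ (mul_pos hn0 (hθ k)) hn0]
        have : θ (k + 1) * (1 - n * θ k) ≤ θ k := by
          nlinarith [hanti k, hθ k, hθ (k + 1), mul_pos hn0 (hθ k)]
        nlinarith
      rw [l1norm_smul, abs_of_nonneg (div_nonneg (mul_nonneg (hθ _).le
        (sub_nonneg.2 (hθn k))) (mul_pos hn0 (hθ k)).le)]
      exact mul_le_mul_of_nonneg_right hc (l1norm_nonneg _)

lemma l1norm_delay_error_le (hr : IsRun f h γ θ idx j x y z w) (hn : 1 ≤ n)
    (hθ : ∀ k, 0 < θ k) (hθn : ∀ k, n * θ k ≤ 1) (hanti : ∀ k, θ (k + 1) ≤ θ k) (l k : ℕ)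
    (hlk : l ≤ k) :
    l1norm (y k - (y l + (∑ i ∈ Finset.Icc (l + 1) k, momentumProd θ (l + 1) i) • (y l - x l)))
      ≤ ∑ i ∈ Finset.Ico l k, (1 + ((k : ℝ) - i) / n) * l1norm (x (i + 1) - y i) := by
  induction k, hlk using Nat.le_induction with
  | base => simp [l1norm_zero]
  | succ k hk ih =>
    have hs : y (k + 1) - (y l
          + (∑ i ∈ Finset.Icc (l + 1) (k + 1), momentumProd θ (l + 1) i) • (y l - x l))
        = (y k - (y l + (∑ i ∈ Finset.Icc (l + 1) k, momentumProd θ (l + 1) i) • (y l - x l)))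
          + (x (k + 1) - y k)
          + (y (k + 1) - x (k + 1) - momentumProd θ (l + 1) (k + 1) • (y l - x l)) := by
      rw [Finset.sum_Icc_succ_top (by omega)]
      module
    have h1 := hr.l1norm_momentum_error_le hn hθ hθn hanti l (k + 1) (by omega)
    have h2 : ∑ i ∈ Finset.Ico l (k + 1), (1 + (((k + 1 : ℕ) : ℝ) - i) / n)
          * l1norm (x (i + 1) - y i)
        = ∑ i ∈ Finset.Ico l k, (1 + ((k : ℝ) - i) / n) * l1norm (x (i + 1) - y i)
          + l1norm (x (k + 1) - y k)
          + 1 / n * ∑ i ∈ Finset.Ico l (k + 1), l1norm (x (i + 1) - y i) := by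
      rw [Finset.sum_Ico_succ_top hk, Finset.sum_Ico_succ_top hk, mul_add, Finset.mul_sum]
      have h3 : ∑ i ∈ Finset.Ico l k, (1 + (((k + 1 : ℕ) : ℝ) - i) / n) * l1norm (x (i + 1) - y i)
          = ∑ i ∈ Finset.Ico l k, (1 + ((k : ℝ) - i) / n) * l1norm (x (i + 1) - y i)
            + ∑ i ∈ Finset.Ico l k, 1 / n * l1norm (x (i + 1) - y i) := by
        rw [← Finset.sum_add_distrib]
        refine Finset.sum_congr rfl fun i _ => ?_
        push_cast
        ring
      rw [h3]
      push_cast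
      ring
    rw [hs, h2]
    exact (l1norm_add_le _ _).trans
      (add_le_add ((l1norm_add_le _ _).trans (add_le_add ih le_rfl)) h1)

end IsRun

/-- The weight with which a step made `d ≥ 1` iterations ago enters the bound on the error of a
read whose delay is at most `τ`. -/
noncomputable def delayWeight (n τ d : ℕ) : ℝ :=
  if d ≤ τ then 1 + (d : ℝ) / n else 0

/-- The total of the weights `delayWeight n τ 1, …, delayWeight n τ τ`. -/
noncomputable def delayTotal (n τ : ℕ) : ℝ :=
  τ + ((τ : ℝ) ^ 2 + τ) / (2 * n)

lemma delayWeight_nonneg (n τ d : ℕ) : 0 ≤ delayWeight n τ d := by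
  unfold delayWeight
  split_ifs
  · positivity
  · exact le_rfl

lemma delayTotal_nonneg (n τ : ℕ) : 0 ≤ delayTotal n τ := by
  unfold delayTotal
  positivity

lemma sum_delayWeight_le (n τ m : ℕ) :
    ∑ r ∈ Finset.range m, delayWeight n τ (r + 1) ≤ delayTotal n τ := by
  have h1 : ∀ t : ℕ, ∑ r ∈ Finset.range t, (1 + ((r + 1 : ℕ) : ℝ) / n)
      = t + ((t : ℝ) ^ 2 + t) / (2 * n) := by
    intro t
    induction t with
    | zero => simp
    | succ t ih =>
      rw [Finset.sum_range_succ, ih]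
      rcases Nat.eq_zero_or_pos n with rfl | hn
      · simp
      · push_cast
        field_simp
        ring
  unfold delayTotal delayWeight
  rw [← h1, ← Finset.sum_filter]
  refine Finset.sum_le_sum_of_subset_of_nonneg (fun r hr => ?_) fun r _ _ => by positivity
  have := (Finset.mem_filter.1 hr).2
  exact Finset.mem_range.2 (by omega)

lemma sum_range_delayWeight_sub_le (n τ k : ℕ) :
    ∑ i ∈ Finset.range k, delayWeight n τ (k - i) ≤ delayTotal n τ := by
  rw [← Finset.sum_range_reflect]
  refine le_of_eq_of_le (Finset.sum_congr rfl fun r hr => ?_) (sum_delayWeight_le n τ k)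
  rw [Finset.mem_range] at hr
  congr 1
  omega

/-- Abstract telescoping with delays: the gain `κ gₖ` of iteration `k` pays for the errors it
causes in the next `τ` iterations. -/
lemma le_of_delayed_descent {T g : ℕ → ℝ} {n τ : ℕ} {C κ : ℝ} (hC : 0 ≤ C) (hg : ∀ k, 0 ≤ g k)
    (hCκ : C * delayTotal n τ ≤ κ)
    (hstep : ∀ k, T (k + 1) + κ * g k
      ≤ T k + C * ∑ i ∈ Finset.range k, delayWeight n τ (k - i) * g i) (K : ℕ) :
    T K ≤ T 0 := by
  have h1 : ∀ K, T K + κ * ∑ k ∈ Finset.range K, g k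
      ≤ T 0 + C * ∑ k ∈ Finset.range K, ∑ i ∈ Finset.range k, delayWeight n τ (k - i) * g i := by
    intro K
    induction K with
    | zero => simp
    | succ K ih =>
      rw [Finset.sum_range_succ, Finset.sum_range_succ]
      linarith [hstep K]
  have h2 : ∑ k ∈ Finset.range K, ∑ i ∈ Finset.range k, delayWeight n τ (k - i) * g i
      ≤ delayTotal n τ * ∑ i ∈ Finset.range K, g i := by
    rw [Finset.sum_comm' (t' := Finset.range K) (s' := fun i => Finset.Ico (i + 1) K)
      (fun k i => by simp only [Finset.mem_range, Finset.mem_Ico]; omega), Finset.mul_sum]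
    refine Finset.sum_le_sum fun i _ => ?_
    rw [← Finset.sum_mul]
    refine mul_le_mul_of_nonneg_right ?_ (hg i)
    rw [Finset.sum_Ico_eq_sum_range]
    refine le_of_eq_of_le (Finset.sum_congr rfl fun r _ => ?_) (sum_delayWeight_le n τ _)
    congr 1
    omega
  have h3 : 0 ≤ ∑ k ∈ Finset.range K, g k := Finset.sum_nonneg fun k _ => hg k
  have h4 := mul_le_mul_of_nonneg_left h2 hC
  have h5 := mul_le_mul_of_nonneg_right hCκ h3
  linarith [h1 K]

namespace IsRun

variable {n : ℕ} {f : EuclideanSpace ℝ (Fin n) → ℝ} {h : Fin n → ℝ → ℝ} {γ : ℝ} {θ : ℕ → ℝ}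
  {idx : ℕ → Fin n} {j : ℕ → ℕ} {x y z w : ℕ → EuclideanSpace ℝ (Fin n)}

/-- The squared error of a compensated delayed read is controlled by the squares of the last `τ`
steps. -/
lemma l1norm_y_sub_w_sq_le (hr : IsRun f h γ θ idx j x y z w) (hn : 1 ≤ n)
    (hθ : ∀ k, 0 < θ k) (hθn : ∀ k, n * θ k ≤ 1) (hanti : ∀ k, θ (k + 1) ≤ θ k) {τ k : ℕ}
    (hj : j k ≤ k ∧ k ≤ j k + τ) :
    l1norm (y k - w k) ^ 2 ≤ delayTotal n τ
      * ∑ i ∈ Finset.range k, delayWeight n τ (k - i) * l1norm (x (i + 1) - y i) ^ 2 := by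
  have h1 : l1norm (y k - w k)
      ≤ ∑ i ∈ Finset.range k, delayWeight n τ (k - i) * l1norm (x (i + 1) - y i) := by
    rw [hr.w_eq]
    refine (hr.l1norm_delay_error_le hn hθ hθn hanti _ _ hj.1).trans ?_
    refine le_of_eq_of_le (Finset.sum_congr rfl fun i hi => ?_)
      (Finset.sum_le_sum_of_subset_of_nonneg (fun i hi => ?_) fun i _ _ =>
        mul_nonneg (delayWeight_nonneg _ _ _) (l1norm_nonneg _))
    · rw [Finset.mem_Ico] at hi
      rw [delayWeight, if_pos (by omega), Nat.cast_sub hi.2.le]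
    · rw [Finset.mem_Ico] at hi
      exact Finset.mem_range.2 hi.2
  have h2 : (∑ i ∈ Finset.range k, delayWeight n τ (k - i) * l1norm (x (i + 1) - y i)) ^ 2
      ≤ (∑ i ∈ Finset.range k, delayWeight n τ (k - i))
        * ∑ i ∈ Finset.range k, delayWeight n τ (k - i) * l1norm (x (i + 1) - y i) ^ 2 :=
    Finset.sum_sq_le_sum_mul_sum_of_sq_le_mul _ (fun i _ => delayWeight_nonneg _ _ _)
      (fun i _ => mul_nonneg (delayWeight_nonneg _ _ _) (sq_nonneg _)) fun i _ => le_of_eq (by ring)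
  calc _ ≤ _ := pow_le_pow_left₀ (l1norm_nonneg _) h1 2
    _ ≤ _ := h2
    _ ≤ _ := mul_le_mul_of_nonneg_right (sum_range_delayWeight_sub_le n τ k)
      (Finset.sum_nonneg fun i _ => mul_nonneg (delayWeight_nonneg _ _ _) (sq_nonneg _))

lemma separable_le_separableBound (hr : IsRun f h γ θ idx j x y z w) (hn : 1 ≤ n)
    (hh : ∀ i, ConvexOn ℝ Set.univ (h i))
    (hθ : ∀ k, 0 < θ k) (hθn : ∀ k, n * θ k ≤ 1) (hanti : ∀ k, θ (k + 1) ≤ θ k) (k : ℕ) :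
    separable h (x k) ≤ separableBound h θ z k := by
  have hH := convexOn_separable hh
  have hn1 : (1 : ℝ) ≤ n := by exact_mod_cast hn
  -- The weight `e` of `zᵏ` in `xᵏ` is singled out, since part of it is removed in the next step.
  obtain ⟨e, he0, he1, -, v, hv, hb⟩ : ∃ e, 0 ≤ e ∧ e ≤ 1 ∧ n * θ k ≤ e ∧ ∃ v,
      x k = e • z k + (1 - e) • v ∧
      e * separable h (z k) + (1 - e) * separable h v ≤ separableBound h θ z k := by
    induction k with
    | zero =>
      exact ⟨1, zero_le_one, le_rfl, hθn 0, 0, by simp [hr.x_zero, hr.z_zero],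
        by simp [separableBound]⟩
    | succ k ih =>
      obtain ⟨e, he0, he1, hek, v, hv, hb⟩ := ih
      have hθ1 : 0 ≤ 1 - θ k := by nlinarith [hθn k, hθ k]
      have hα : 0 ≤ (1 - θ k) * e - (n - 1) * θ k := by
        nlinarith [hθn k, hθ k, mul_le_mul_of_nonneg_left hek hθ1]
      obtain ⟨v', hv', hb'⟩ := exists_convex_combination hH (z k) v hα
        (mul_nonneg hθ1 (sub_nonneg.2 he1))
      rw [show (1 - θ k) * e - (n - 1) * θ k + (1 - θ k) * (1 - e) = 1 - n * θ k by ring]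
        at hv' hb'
      refine ⟨n * θ k, mul_nonneg (by positivity) (hθ k).le, hθn k,
        mul_le_mul_of_nonneg_left (hanti k) (by positivity), v', ?_, ?_⟩
      · rw [hv', hr.x_step, hv]
        module
      · have := mul_le_mul_of_nonneg_left hb hθ1
        rw [separableBound]
        linarith
  refine le_trans ?_ hb
  rw [hv]
  exact hH.2 (Set.mem_univ _) (Set.mem_univ _) he0 (sub_nonneg.2 he1) (by ring)

lemma z_succ_eq_proxStep (hr : IsRun f h γ θ idx j x y z w) (hn : 1 ≤ n) (hγ : 0 < γ)
    (hh : ∀ i, ConvexOn ℝ Set.univ (h i)) (hθ : ∀ k, 0 < θ k) (k : ℕ) :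
    z (k + 1) = z k + EuclideanSpace.single (idx k)
      (proxStep (h (idx k)) (gradient f (w k) (idx k)) (n * θ k / (2 * γ)) (z k (idx k))) := by
  obtain ⟨δ, hδ, hz⟩ := hr.z_step k
  have hn0 : (0 : ℝ) < n := by exact_mod_cast hn
  have := hθ k
  rw [hz, ← eq_proxStep (hh (idx k)) (by positivity) hδ]

/-- A run is determined by the updated coordinates and the read indices. -/
lemma eq_of_eq {idx' : ℕ → Fin n} {j' : ℕ → ℕ} {x' y' z' w' : ℕ → EuclideanSpace ℝ (Fin n)}
    (hr : IsRun f h γ θ idx j x y z w) (hr' : IsRun f h γ θ idx' j' x' y' z' w') (hn : 1 ≤ n)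
    (hγ : 0 < γ) (hh : ∀ i, ConvexOn ℝ Set.univ (h i)) (hθ : ∀ k, 0 < θ k)
    {τ : ℕ} (hj : ∀ k, j k ≤ k ∧ k ≤ j k + τ) (k : ℕ)
    (hidx : ∀ l < k, idx l = idx' l) (hjj : ∀ l ≤ k, j l = j' l) :
    x k = x' k ∧ y k = y' k ∧ z k = z' k ∧ w k = w' k := by
  induction k using Nat.strong_induction_on with
  | _ k ih =>
    have hxz : x k = x' k ∧ z k = z' k := by
      cases k with
      | zero => exact ⟨hr.x_zero.trans hr'.x_zero.symm, hr.z_zero.trans hr'.z_zero.symm⟩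
      | succ k =>
        obtain ⟨h1, h2, h3, h4⟩ := ih k (by omega) (fun l hl => hidx l (by omega))
          fun l hl => hjj l (by omega)
        have hz : z (k + 1) = z' (k + 1) := by
          rw [hr.z_succ_eq_proxStep hn hγ hh hθ, hr'.z_succ_eq_proxStep hn hγ hh hθ, h3, h4,
            hidx k (by omega)]
        exact ⟨by rw [hr.x_step, hr'.x_step, h1, h3, hz], hz⟩
    have hy : y k = y' k := by rw [hr.y_eq, hr'.y_eq, hxz.1, hxz.2]
    refine ⟨hxz.1, hy, hxz.2, ?_⟩
    have hread : x (j k) = x' (j k) ∧ y (j k) = y' (j k) := by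
      rcases (hj k).1.eq_or_lt with h0 | h0
      · rw [h0]; exact ⟨hxz.1, hy⟩
      · have := ih (j k) h0 (fun l hl => hidx l (by omega)) fun l hl => hjj l (by omega)
        exact ⟨this.1, this.2.1⟩
    rw [hr.w_eq, hr'.w_eq, ← hjj k le_rfl, hread.1, hread.2]

end IsRun

/-! ### Expectations -/

/-- Everything that happened before `idx k` is drawn. -/
def history {n : ℕ} {Ω : Type*} (idx : ℕ → Ω → Fin n) (j : ℕ → Ω → ℕ) (k : ℕ) (ω : Ω) :
    (Fin k → Fin n) × (Fin (k + 1) → ℕ) :=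
  (fun l => idx l ω, fun l => j l ω)

namespace IsSampling

variable {n τ : ℕ} {Ω : Type*} [MeasurableSpace Ω] {P : Measure Ω}
  {idx : ℕ → Ω → Fin n} {j : ℕ → Ω → ℕ}

lemma measurable_history (hs : IsSampling P τ idx j) (k : ℕ) : Measurable (history idx j k) :=
  (measurable_pi_lambda (fun ω (l : Fin k) => idx l ω) fun l => hs.measurable_idx l).prodMk
    (measurable_pi_lambda (fun ω (l : Fin (k + 1)) => j l ω) fun l => hs.measurable_j l)

lemma finite_range_history (hs : IsSampling P τ idx j) (k : ℕ) :
    (Set.range (history idx j k)).Finite := by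
  refine ((Set.finite_univ (α := Fin k → Fin n)).prod
    (Set.finite_Icc (0 : Fin (k + 1) → ℕ) fun _ => k)).subset ?_
  rintro _ ⟨ω, rfl⟩
  exact ⟨Set.mem_univ _, fun _ => Nat.zero_le _,
    fun l => (hs.delay l ω).1.trans (Nat.lt_succ_iff.1 l.2)⟩

/-- A function of the history takes finitely many values, so it is integrable. -/
lemma integrable_of_history [IsProbabilityMeasure P] (hs : IsSampling P τ idx j) (k : ℕ)
    {X : Ω → ℝ} (hX : Function.FactorsThrough X (history idx j k)) : Integrable X P := by
  have hX' := hX.extend_comp (fun _ => (0 : ℝ))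
  rw [← hX']
  obtain ⟨C, hC⟩ := (((hs.finite_range_history k).image
    (Function.extend (history idx j k) X fun _ => (0 : ℝ))).isBounded).exists_norm_le
  refine Integrable.of_bound (C := C) ?_ (Filter.Eventually.of_forall fun ω =>
    hC _ ⟨_, ⟨ω, rfl⟩, rfl⟩)
  exact ((measurable_of_countable _).comp (hs.measurable_history k)).aestronglyMeasurable

/-- Given the history, the coordinate drawn next is uniform: the expectation of a quantity depending
on the history and that coordinate is obtained by averaging over the coordinate. -/
lemma integral_idx_eq [IsProbabilityMeasure P] (hs : IsSampling P τ idx j) (k : ℕ)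
    {Ψ : Ω → Fin n → ℝ} (hΨ : ∀ i, Function.FactorsThrough (fun ω => Ψ ω i) (history idx j k)) :
    ∫ ω, Ψ ω (idx k ω) ∂P = ∫ ω, 1 / n * ∑ i, Ψ ω i ∂P := by
  have hint := fun i => hs.integrable_of_history k (hΨ i)
  have hmeas : ∀ i, MeasurableSet {ω | idx k ω = i} := fun i =>
    hs.measurable_idx k (measurableSet_singleton i)
  have h1 : ∀ ω, Ψ ω (idx k ω) = ∑ i, Set.indicator {ω | idx k ω = i} (fun ω => Ψ ω i) ω := by
    intro ω
    rw [Finset.sum_eq_single (idx k ω)]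
    · simp
    · intro i _ hi
      exact Set.indicator_of_notMem (fun h => hi h.symm) _
    · simp
  have h2 : ∀ i, ∫ ω, Set.indicator {ω | idx k ω = i} (fun ω => Ψ ω i) ω ∂P
      = 1 / n * ∫ ω, Ψ ω i ∂P := by
    intro i
    have hind : IndepFun (fun ω => Set.indicator {i} (fun _ => (1 : ℝ)) (idx k ω))
        (fun ω => Ψ ω i) P := by
      have := (hs.indep k).comp (φ := Set.indicator {i} (fun _ => (1 : ℝ)))
        (ψ := Function.extend (history idx j k) (fun ω => Ψ ω i) fun _ => (0 : ℝ))
        (measurable_of_countable _) (measurable_of_countable _)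
      convert this using 1
      · rfl
      · exact ((hΨ i).extend_comp (fun _ => (0 : ℝ))).symm
    have hm := hind.integral_fun_mul_eq_mul_integral
      ((measurable_of_countable (Set.indicator {i} (fun _ => (1 : ℝ)))).comp
        (hs.measurable_idx k)).aestronglyMeasurable
      (hint i).aestronglyMeasurable
    have h3 : ∀ ω, Set.indicator {ω | idx k ω = i} (fun ω => Ψ ω i) ω
        = Set.indicator {i} (fun _ => (1 : ℝ)) (idx k ω) * Ψ ω i := by
      intro ω
      by_cases h : idx k ω = i <;> simp [Set.indicator, h]
    have h4 : ∫ ω, Set.indicator {i} (fun _ => (1 : ℝ)) (idx k ω) ∂P = 1 / n := by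
      rw [← hs.uniform k i, ← integral_indicator_one (hmeas i)]
      refine integral_congr_ae (Filter.Eventually.of_forall fun ω => ?_)
      by_cases h : idx k ω = i <;> simp [Set.indicator, h]
    rw [← h4, ← hm]
    exact integral_congr_ae (Filter.Eventually.of_forall h3)
  simp_rw [h1]
  rw [integral_finsetSum _ fun i _ => (hint i).indicator (hmeas i), integral_const_mul,
    integral_finsetSum _ fun i _ => hint i, Finset.mul_sum]
  exact Finset.sum_congr rfl fun i _ => h2 i

end IsSampling

lemma integral_combination {Ω : Type*} [MeasurableSpace Ω] {P : Measure Ω} {a b c d : Ω → ℝ}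
    (ha : Integrable a P) (hb : Integrable b P) (hc : Integrable c P) (hd : Integrable d P)
    (p q : ℝ) :
    ∫ ω, (a ω + b ω + p * c ω + q * d ω) ∂P
      = (∫ ω, a ω ∂P) + (∫ ω, b ω ∂P) + p * (∫ ω, c ω ∂P) + q * ∫ ω, d ω ∂P := by
  have h1 : Integrable (fun ω => a ω + b ω) P := ha.add hb
  have h2 : Integrable (fun ω => a ω + b ω + p * c ω) P := h1.add (hc.const_mul p)
  rw [integral_add h2 (hd.const_mul q), integral_add h1 (hc.const_mul p), integral_add ha hb,
    integral_const_mul, integral_const_mul]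

/-- A weighted potential does not increase in expectation, provided the weights `Λ` grow no faster
than the contraction of each iteration allows, and by a factor of at most `ρ` within the delay. -/
theorem expected_potential_le {n τ : ℕ} (hn : 1 ≤ n) {f : EuclideanSpace ℝ (Fin n) → ℝ}
    {h : Fin n → ℝ → ℝ} {L γ μ ρ : ℝ} {θ Λ U : ℕ → ℝ}
    (hf : ConvexOn ℝ Set.univ f) (hd : Differentiable ℝ f) (hL : CoordLipschitzGradient f L)
    (hh : ∀ i, StrongConvexOn Set.univ μ (h i)) (hμ : 0 ≤ μ) (hγ : 0 < γ)
    {u : EuclideanSpace ℝ (Fin n)} (hu : IsMinOn (objective f h) Set.univ u)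
    {Ω : Type*} [MeasurableSpace Ω] {P : Measure Ω} [IsProbabilityMeasure P]
    {idx : ℕ → Ω → Fin n} {j : ℕ → Ω → ℕ} (hs : IsSampling P τ idx j)
    {x y z w : ℕ → Ω → EuclideanSpace ℝ (Fin n)}
    (hr : ∀ ω, IsRun f h γ θ (fun k => idx k ω) (fun k => j k ω)
      (fun k => x k ω) (fun k => y k ω) (fun k => z k ω) (fun k => w k ω))
    (hθ : ∀ k, 0 < θ k) (hθn : ∀ k, n * θ k ≤ 1) (hanti : ∀ k, θ (k + 1) ≤ θ k)
    (hΛ : ∀ k, 0 < Λ k) (hU : ∀ k, U (k + 1) = n ^ 2 * θ k ^ 2 / (2 * γ) + n * θ k * μ / 2)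
    (hΛθ : ∀ k, Λ (k + 1) * (1 - θ k) ≤ Λ k)
    (hΛU : ∀ k, Λ (k + 1) * (n ^ 2 * θ k ^ 2 / (2 * γ) + (n - 1) * θ k * μ / 2) ≤ Λ k * U k)
    (hΛρ : ∀ i k, i ≤ k → k ≤ i + τ → Λ (k + 1) ≤ ρ * Λ (i + 1))
    (hcond : L * delayTotal n τ ^ 2 * ρ ≤ 1 / (2 * γ) - L) (K : ℕ) :
    Integrable (fun ω => objective f h (x K ω)) P ∧
    Integrable (fun ω => ‖z K ω - u‖ ^ 2) P ∧
    Λ K * ((∫ ω, objective f h (x K ω) ∂P) - objective f h u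
        + U K * ∫ ω, ‖z K ω - u‖ ^ 2 ∂P)
      ≤ Λ 0 * (objective f h 0 - objective f h u + U 0 * ‖0 - u‖ ^ 2) := by
  have hn0 : (0 : ℝ) < n := by exact_mod_cast hn
  have hL0 := hL.nonneg hn
  have hS0 := delayTotal_nonneg n τ
  have hθ1 : ∀ k, θ k ≤ 1 := fun k => by
    have : (1 : ℝ) ≤ n := by exact_mod_cast hn
    nlinarith [hθ k, hθn k]
  have hhc : ∀ i, ConvexOn ℝ Set.univ (h i) := fun i =>
    strongConvexOn_zero.1 ((hh i).mono hμ)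
  have hdet : ∀ k ω ω', history idx j k ω = history idx j k ω' →
      x k ω = x k ω' ∧ y k ω = y k ω' ∧ z k ω = z k ω' ∧ w k ω = w k ω' := by
    intro k ω ω' hω
    refine (hr ω).eq_of_eq (hr ω') hn hγ hhc hθ (fun k => hs.delay k ω) k (fun l hl => ?_)
      fun l hl => ?_
    · exact congrFun (congrArg Prod.fst hω) ⟨l, hl⟩
    · exact congrFun (congrArg Prod.snd hω) ⟨l, Nat.lt_succ_of_le hl⟩
  have hint : ∀ k (G : EuclideanSpace ℝ (Fin n) → EuclideanSpace ℝ (Fin n) →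
      EuclideanSpace ℝ (Fin n) → EuclideanSpace ℝ (Fin n) → ℝ),
      Integrable (fun ω => G (x k ω) (y k ω) (z k ω) (w k ω)) P := by
    intro k G
    refine hs.integrable_of_history k fun ω ω' hω => ?_
    obtain ⟨h1, h2, h3, h4⟩ := hdet k ω ω' hω
    simp only [h1, h2, h3, h4]
  have hintF : ∀ k, Integrable (fun ω => objective f h (x k ω)) P := fun k =>
    hint k fun x _ _ _ => objective f h x
  have hintf : ∀ k, Integrable (fun ω => f (x k ω)) P := fun k => hint k fun x _ _ _ => f x
  have hintz : ∀ k, Integrable (fun ω => ‖z k ω - u‖ ^ 2) P := fun k =>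
    hint k fun _ _ z _ => ‖z - u‖ ^ 2
  have hinth : ∀ k, Integrable (fun ω => separable h (z k ω)) P := fun k =>
    hint k fun _ _ z _ => separable h z
  have hintb : ∀ k, Integrable (fun ω => separableBound h θ (fun k => z k ω) k) P := by
    intro k
    induction k with
    | zero => exact hinth 0
    | succ k ih =>
      exact (ih.const_mul _).add (((hinth (k + 1)).const_mul _).sub ((hinth k).const_mul _))
  have hstep : ∀ k ω, x (k + 1) ω - y k ω = (n * θ k) • (z (k + 1) ω - z k ω) := fun k ω =>
    (hr ω).x_succ_sub_y k
  have hintg : ∀ k, Integrable (fun ω => l1norm (x (k + 1) ω - y k ω) ^ 2) P := by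
    intro k
    refine hs.integrable_of_history (k + 1) fun ω ω' hω => ?_
    have hω' : history idx j k ω = history idx j k ω' := Prod.ext
      (funext fun l => congrFun (congrArg Prod.fst hω) l.castSucc)
      (funext fun l => congrFun (congrArg Prod.snd hω) l.castSucc)
    simp only [(hdet _ _ _ hω).1, (hdet _ _ _ hω').2.1]
  -- `A k` bounds the expected objective value at `xᵏ`; `B k`, `G k` are the expected squares of the
  -- distance to the minimizer and of the step.
  set A : ℕ → ℝ := fun k => (∫ ω, f (x k ω) ∂P)
    + (∫ ω, separableBound h θ (fun k => z k ω) k ∂P) - objective f h u with hA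
  set B : ℕ → ℝ := fun k => ∫ ω, ‖z k ω - u‖ ^ 2 ∂P with hB
  set G : ℕ → ℝ := fun k => ∫ ω, l1norm (x (k + 1) ω - y k ω) ^ 2 ∂P with hG
  have hB0 : ∀ k, 0 ≤ B k := fun k => integral_nonneg fun ω => sq_nonneg _
  have hG0 : ∀ k, 0 ≤ G k := fun k => integral_nonneg fun ω => sq_nonneg _
  have hFA : ∀ k, (∫ ω, objective f h (x k ω) ∂P) - objective f h u ≤ A k := by
    intro k
    rw [hA]
    refine sub_le_sub_right ?_ _
    rw [← integral_add (hintf k) (hintb k)]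
    exact integral_mono (hintF k) ((hintf k).add (hintb k)) fun ω =>
      add_le_add le_rfl ((hr ω).separable_le_separableBound hn hhc hθ hθn hanti k)
  have hA0 : ∀ k, 0 ≤ A k := by
    intro k
    refine le_trans (sub_nonneg.2 ?_) (hFA k)
    calc objective f h u = ∫ _, objective f h u ∂P := by simp
      _ ≤ _ := integral_mono (integrable_const _) (hintF k) fun ω =>
        isMinOn_iff.1 hu _ (Set.mem_univ _)
  have hdescent : ∀ k, A (k + 1) + U (k + 1) * B (k + 1) + (1 / (2 * γ) - L) * G k
      ≤ (1 - θ k) * A k + (n ^ 2 * θ k ^ 2 / (2 * γ) + (n - 1) * θ k * μ / 2) * B k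
        + L * delayTotal n τ * ∑ i ∈ Finset.range k, delayWeight n τ (k - i) * G i := by
    intro k
    set d : Ω → Fin n → ℝ := fun ω i =>
      proxStep (h i) (gradient f (w k ω) i) (n * θ k / (2 * γ)) (z k ω i) with hdd
    set Ψ : Ω → Fin n → ℝ := fun ω i => f (y k ω + EuclideanSpace.single i (n * θ k * d ω i))
        + (n * θ k * separable h (z k ω + EuclideanSpace.single i (d ω i))
          - (n - 1) * θ k * separable h (z k ω))
        + (n ^ 2 * θ k ^ 2 / (2 * γ) + n * θ k * μ / 2)
          * ‖z k ω + EuclideanSpace.single i (d ω i) - u‖ ^ 2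
        + (1 / (2 * γ) - L) * (n * θ k * d ω i) ^ 2 with hΨ
    have hfac : ∀ i, Function.FactorsThrough (fun ω => Ψ ω i) (history idx j k) := by
      intro i ω ω' hω
      obtain ⟨-, h2, h3, h4⟩ := hdet k ω ω' hω
      simp only [hΨ, hdd, h2, h3, h4]
    have hz : ∀ ω, z (k + 1) ω = z k ω + EuclideanSpace.single (idx k ω) (d ω (idx k ω)) :=
      fun ω => (hr ω).z_succ_eq_proxStep hn hγ hhc hθ k
    have hxy : ∀ ω, x (k + 1) ω - y k ω
        = EuclideanSpace.single (idx k ω) (n * θ k * d ω (idx k ω)) := by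
      intro ω
      rw [hstep, hz, add_sub_cancel_left]
      ext l
      by_cases hl : l = idx k ω <;> simp [hl]
    have hΨk : ∀ ω, Ψ ω (idx k ω) = f (x (k + 1) ω)
        + (n * θ k * separable h (z (k + 1) ω) - (n - 1) * θ k * separable h (z k ω))
        + U (k + 1) * ‖z (k + 1) ω - u‖ ^ 2
        + (1 / (2 * γ) - L) * l1norm (x (k + 1) ω - y k ω) ^ 2 := by
      intro ω
      simp only [hΨ]
      rw [← hz, ← hxy, add_sub_cancel, hxy, l1norm_single, sq_abs, hU]
    have hone : ∀ ω, 1 / n * ∑ i, Ψ ω i ≤ (1 - θ k) * f (x k ω) + θ k * objective f h u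
        + (n ^ 2 * θ k ^ 2 / (2 * γ) + (n - 1) * θ k * μ / 2) * ‖z k ω - u‖ ^ 2
        + L * delayTotal n τ * ∑ i ∈ Finset.range k, delayWeight n τ (k - i)
          * l1norm (x (i + 1) ω - y i ω) ^ 2 := by
      intro ω
      have hθk := hθ k
      have h1 := one_step hn hf hd hL hh hγ (hθ k) (hθ1 k) (x k ω) (y k ω) (z k ω) (w k ω) u
        (d ω) ((hr ω).y_eq k) fun i => isMinOn_proxStep (hhc i) _ (by positivity) _
      have h2 := mul_le_mul_of_nonneg_left ((hr ω).l1norm_y_sub_w_sq_le hn hθ hθn hanti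
        (hs.delay k ω)) hL0
      rw [← mul_assoc] at h2
      exact h1.trans (add_le_add le_rfl h2)
    have hisum : Integrable (fun ω => ∑ i ∈ Finset.range k, delayWeight n τ (k - i)
        * l1norm (x (i + 1) ω - y i ω) ^ 2) P :=
      integrable_finsetSum _ fun i _ => (hintg i).const_mul _
    have hiΨ : Integrable (fun ω => 1 / n * ∑ i, Ψ ω i) P :=
      (integrable_finsetSum _ fun i _ => hs.integrable_of_history k (hfac i)).const_mul _
    have hmain := (hs.integral_idx_eq k hfac).trans_le (integral_mono hiΨ
      ((((hintf k).const_mul _).add (integrable_const _)).add ((hintz k).const_mul _) |>.add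
        (hisum.const_mul _)) hone)
    simp_rw [hΨk] at hmain
    have hi1 : Integrable (fun ω => n * θ k * separable h (z (k + 1) ω)
        - (n - 1) * θ k * separable h (z k ω)) P :=
      ((hinth (k + 1)).const_mul (n * θ k)).sub ((hinth k).const_mul ((n - 1) * θ k))
    have hlhs : ∫ ω, (f (x (k + 1) ω)
        + (n * θ k * separable h (z (k + 1) ω) - (n - 1) * θ k * separable h (z k ω))
        + U (k + 1) * ‖z (k + 1) ω - u‖ ^ 2
        + (1 / (2 * γ) - L) * l1norm (x (k + 1) ω - y k ω) ^ 2) ∂P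
        = (∫ ω, f (x (k + 1) ω) ∂P)
          + (∫ ω, (n * θ k * separable h (z (k + 1) ω) - (n - 1) * θ k * separable h (z k ω)) ∂P)
          + U (k + 1) * B (k + 1) + (1 / (2 * γ) - L) * G k :=
      integral_combination (hintf (k + 1)) hi1 (hintz (k + 1)) (hintg k) _ _
    have hrhs : ∫ ω, ((1 - θ k) * f (x k ω) + θ k * objective f h u
        + (n ^ 2 * θ k ^ 2 / (2 * γ) + (n - 1) * θ k * μ / 2) * ‖z k ω - u‖ ^ 2
        + L * delayTotal n τ * ∑ i ∈ Finset.range k, delayWeight n τ (k - i)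
          * l1norm (x (i + 1) ω - y i ω) ^ 2) ∂P
        = (1 - θ k) * (∫ ω, f (x k ω) ∂P) + θ k * objective f h u
          + (n ^ 2 * θ k ^ 2 / (2 * γ) + (n - 1) * θ k * μ / 2) * B k
          + L * delayTotal n τ * ∑ i ∈ Finset.range k, delayWeight n τ (k - i) * G i := by
      rw [integral_combination ((hintf k).const_mul (1 - θ k)) (integrable_const _) (hintz k) hisum,
        integral_const_mul, integral_finsetSum _ fun i _ => (hintg i).const_mul _]
      simp [integral_const_mul, hG, hB]
    have hbound : (∫ ω, separableBound h θ (fun k => z k ω) (k + 1) ∂P)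
        = (1 - θ k) * (∫ ω, separableBound h θ (fun k => z k ω) k ∂P)
          + ∫ ω, (n * θ k * separable h (z (k + 1) ω)
            - (n - 1) * θ k * separable h (z k ω)) ∂P := by
      rw [← integral_const_mul, ← integral_add ((hintb k).const_mul _) hi1]
      rfl
    have hmain' := hlhs.symm.trans_le (le_of_le_of_eq hmain hrhs)
    simp only [hA]
    rw [hbound]
    linarith
  refine ⟨hintF K, hintz K, ?_⟩
  have htel := le_of_delayed_descent (n := n) (τ := τ) (T := fun k => Λ k * (A k + U k * B k))
    (g := fun k => Λ (k + 1) * G k) (C := L * delayTotal n τ * ρ) (κ := 1 / (2 * γ) - L) ?_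
    (fun k => mul_nonneg (hΛ _).le (hG0 k)) (le_of_eq_of_le (by ring) hcond) ?_ K
  · have hx0 : ∀ ω, x 0 ω = 0 := fun ω => (hr ω).x_zero
    have hz0 : ∀ ω, z 0 ω = 0 := fun ω => (hr ω).z_zero
    have h0 : A 0 + U 0 * B 0 = objective f h 0 - objective f h u + U 0 * ‖0 - u‖ ^ 2 := by
      simp [hA, hB, separableBound, hx0, hz0, objective]
    simp only [h0] at htel
    refine le_trans (mul_le_mul_of_nonneg_left ?_ (hΛ K).le) htel
    exact add_le_add (hFA K) le_rfl
  · have hρ : 0 ≤ ρ := by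
      have := hΛρ 0 0 le_rfl (Nat.zero_le _)
      nlinarith [hΛ 1]
    positivity
  · intro k
    have h1 := mul_le_mul_of_nonneg_left (hdescent k) (hΛ (k + 1)).le
    have h2 := mul_le_mul_of_nonneg_right (hΛθ k) (hA0 k)
    have h3 := mul_le_mul_of_nonneg_right (hΛU k) (hB0 k)
    have h4 : Λ (k + 1) * ∑ i ∈ Finset.range k, delayWeight n τ (k - i) * G i
        ≤ ρ * ∑ i ∈ Finset.range k, delayWeight n τ (k - i) * (Λ (i + 1) * G i) := by
      rw [Finset.mul_sum, Finset.mul_sum]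
      refine Finset.sum_le_sum fun i hi => ?_
      rw [Finset.mem_range] at hi
      by_cases hk : k - i ≤ τ
      · have := mul_le_mul_of_nonneg_right (hΛρ i k hi.le (by omega))
          (mul_nonneg (delayWeight_nonneg n τ (k - i)) (hG0 i))
        linarith
      · simp [delayWeight, hk]
    have h5 := mul_le_mul_of_nonneg_left h4 (mul_nonneg hL0 hS0)
    linarith

/-! ### The two choices of parameters -/

lemma compensation_eq (n τ : ℕ) :
    ((τ : ℝ) ^ 2 + τ) / n + 2 * τ = 2 * delayTotal n τ := by
  unfold delayTotal
  rcases Nat.eq_zero_or_pos n with rfl | hn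
  · simp
  · field_simp
    ring

/-- Within a delay `τ ≤ √n` the weights `1 / (θᵏ)²` grow by a factor of at most `2 (1 + 1/n)`. -/
lemma sq_le_mul_sq_of_delay {n τ i k : ℕ} (hn : 1 ≤ n) (hτ : (τ : ℝ) ≤ Real.sqrt n)
    (hk : k ≤ i + τ) :
    ((2 * n + k : ℝ) / 2) ^ 2 ≤ 2 * (1 + 1 / n) * ((2 * n + i : ℝ) / 2) ^ 2 := by
  have hn0 : (0 : ℝ) < n := by exact_mod_cast hn
  have hτn : (τ : ℝ) ^ 2 ≤ n := by
    rw [← Real.sq_sqrt hn0.le]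
    exact pow_le_pow_left₀ (Nat.cast_nonneg _) hτ 2
  have hk' : (k : ℝ) ≤ i + τ := by exact_mod_cast hk
  set a : ℝ := 2 * n + i with ha
  have han : 2 * (n : ℝ) ≤ a := le_add_of_nonneg_right (Nat.cast_nonneg i)
  have h1 : (2 * n + k : ℝ) ^ 2 ≤ (a + τ) ^ 2 :=
    pow_le_pow_left₀ (by positivity) (by linarith) 2
  have h2 : 4 * (n : ℝ) ≤ 1 / n * a ^ 2 := by
    rw [one_div_mul_eq_div, le_div_iff₀ hn0]
    nlinarith
  nlinarith [sq_nonneg (a - 2 * τ)]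

lemma thetaNC_eq (n k : ℕ) : thetaNC n k = 2 / (2 * n + k) := by
  simp [thetaNC]

lemma thetaSC_pos {n : ℕ} (hn : 1 ≤ n) {γ μ : ℝ} (hγμ : 0 < γ * μ) : 0 < thetaSC n γ μ := by
  have hn0 : (0 : ℝ) < n := by exact_mod_cast hn
  have h1 : γ * μ < Real.sqrt (γ ^ 2 * μ ^ 2 + 4 * (γ * μ)) :=
    Real.lt_sqrt_of_sq_lt (by nlinarith)
  unfold thetaSC
  exact div_pos (by linarith) (by positivity)

/-- The equation that characterizes the parameter `θ`. -/
lemma thetaSC_equation {n : ℕ} (hn : 1 ≤ n) {γ μ : ℝ} (hγμ : 0 < γ * μ) :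
    (n * thetaSC n γ μ) ^ 2 = γ * μ * (1 - n * thetaSC n γ μ) := by
  have hn0 : (0 : ℝ) < n := by exact_mod_cast hn
  have h1 : Real.sqrt (γ ^ 2 * μ ^ 2 + 4 * (γ * μ)) ^ 2 = γ ^ 2 * μ ^ 2 + 4 * (γ * μ) :=
    Real.sq_sqrt (by positivity)
  have h2 : n * thetaSC n γ μ
      = (-(γ * μ) + Real.sqrt (γ ^ 2 * μ ^ 2 + 4 * (γ * μ))) / 2 := by
    unfold thetaSC
    field_simp
  rw [h2]
  linear_combination h1 / 4

/-- Within a delay `τ ≤ √n` the weights `(1 - θ)⁻ᵏ` grow by a factor of at most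
`3/2 + 3/(4n)`. -/
lemma one_le_mul_one_sub_thetaSC_pow {n τ : ℕ} (hn : 1 ≤ n) (hτ : (τ : ℝ) ≤ Real.sqrt n)
    {L γ μ : ℝ} (hγ : 0 < γ) (hμ : 0 < μ) (hμL : μ ≤ L)
    (hcond : 2 * γ * L + (3 / 4 + 3 / (8 * (n : ℝ))) * γ * L * (2 * delayTotal n τ) ^ 2 ≤ 1)
    {m : ℕ} (hm : m ≤ τ) :
    1 ≤ (3 / 2 + 3 / (4 * (n : ℝ))) * (1 - thetaSC n γ μ) ^ m := by
  have hn0 : (0 : ℝ) < n := by exact_mod_cast hn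
  have hn1 : (1 : ℝ) ≤ n := by exact_mod_cast hn
  have hγμ := mul_pos hγ hμ
  have hθ := thetaSC_pos hn hγμ
  have heq := thetaSC_equation hn hγμ
  have hγL : γ * μ ≤ γ * L := mul_le_mul_of_nonneg_left hμL hγ.le
  rcases Nat.eq_zero_or_pos m with rfl | hm0
  · have : 0 ≤ 3 / (4 * (n : ℝ)) := by positivity
    rw [pow_zero]
    linarith
  have hτ1 : (1 : ℝ) ≤ τ := by exact_mod_cast hm0.trans_le hm
  have hmτ : (m : ℝ) ≤ τ := by exact_mod_cast hm
  have hτn : (τ : ℝ) ^ 2 ≤ n := by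
    rw [← Real.sq_sqrt hn0.le]
    exact pow_le_pow_left₀ (Nat.cast_nonneg _) hτ 2
  -- A positive delay forces the step size down to `γ μ ≤ 1/5`, whence `n θ ≤ 9/25`.
  have hS : 1 ≤ delayTotal n τ := by
    have : 0 ≤ ((τ : ℝ) ^ 2 + τ) / (2 * n) := by positivity
    unfold delayTotal
    linarith
  have h5 : 5 * (γ * L) ≤ 1 := by
    have hγL0 : 0 < γ * L := hγμ.trans_le hγL
    have h1 : (4 : ℝ) ≤ (2 * delayTotal n τ) ^ 2 := by nlinarith
    have h2 : 3 / 4 * 4 ≤ (3 / 4 + 3 / (8 * (n : ℝ))) * (2 * delayTotal n τ) ^ 2 := by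
      have : 0 ≤ 3 / (8 * (n : ℝ)) := by positivity
      exact mul_le_mul (by linarith) h1 (by norm_num) (by linarith)
    nlinarith
  have ht0 : 0 < n * thetaSC n γ μ := mul_pos hn0 hθ
  have ht : n * thetaSC n γ μ ≤ 9 / 25 := by nlinarith
  have hθn : thetaSC n γ μ ≤ n * thetaSC n γ μ := le_mul_of_one_le_left hθ.le hn1
  have hb := one_add_mul_le_pow (a := -thetaSC n γ μ) (by linarith) m
  rw [← sub_eq_add_neg] at hb
  have hq : m * thetaSC n γ μ ≤ τ * thetaSC n γ μ := mul_le_mul_of_nonneg_right hmτ hθ.le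
  have hq2 : n * (τ * thetaSC n γ μ) ^ 2 ≤ (9 / 25) ^ 2 := by
    have h1 : (n * thetaSC n γ μ) ^ 2 ≤ (9 / 25) ^ 2 := pow_le_pow_left₀ ht0.le ht 2
    have h2 : n * (τ * thetaSC n γ μ) ^ 2 ≤ (n * thetaSC n γ μ) ^ 2 := by
      have := mul_le_mul_of_nonneg_right hτn (mul_nonneg hn0.le (sq_nonneg (thetaSC n γ μ)))
      linarith
    exact h2.trans h1
  have hq0 : 0 ≤ τ * thetaSC n γ μ := by positivity
  have hpow : 1 - τ * thetaSC n γ μ ≤ (1 - thetaSC n γ μ) ^ m := by linarith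
  rcases hn.eq_or_lt with rfl | hn2
  · have : τ * thetaSC 1 γ μ ≤ 9 / 25 := by
      refine le_of_sq_le_sq ?_ (by norm_num)
      simpa using hq2
    norm_num at hpow ⊢
    linarith
  · have hn2' : (2 : ℝ) ≤ n := by exact_mod_cast hn2
    have h1 : τ * thetaSC n γ μ ≤ 1 / 3 := by
      nlinarith [sq_nonneg (τ * thetaSC n γ μ)]
    have h2 : 3 / 2 * (2 / 3) ≤ (3 / 2 + 3 / (4 * (n : ℝ))) * (1 - thetaSC n γ μ) ^ m :=
      mul_le_mul (le_add_of_nonneg_right (by positivity)) (by linarith) (by norm_num)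
        (by positivity)
    linarith

end AASCD

theorem theorem2 {n τ : ℕ} (hn : 1 ≤ n) (hτ : (τ : ℝ) ≤ Real.sqrt n)
    (f : EuclideanSpace ℝ (Fin n) → ℝ) (h : Fin n → ℝ → ℝ) (Lc γ : ℝ)
    (hf : ConvexOn ℝ Set.univ f) (hf_diff : Differentiable ℝ f)
    (hf_lip : AASCD.CoordLipschitzGradient f Lc)
    (hh : ∀ i, ConvexOn ℝ Set.univ (h i)) (hγ : 0 < γ)
    (xs : EuclideanSpace ℝ (Fin n)) (hxs : IsMinOn (AASCD.objective f h) Set.univ xs)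
    {Ω : Type*} [MeasurableSpace Ω] (P : Measure Ω) [IsProbabilityMeasure P]
    (idx : ℕ → Ω → Fin n) (j : ℕ → Ω → ℕ) (hs : AASCD.IsSampling P τ idx j)
    (x y z w : ℕ → Ω → EuclideanSpace ℝ (Fin n)) :
    ((2 * γ * Lc + (1 + 1 / (n : ℝ)) * γ * Lc * (((τ : ℝ) ^ 2 + τ) / n + 2 * τ) ^ 2 ≤ 1 ∧
        ∀ ω, AASCD.IsRun f h γ (fun k => AASCD.thetaNC n k) (fun k => idx k ω) (fun k => j k ω)
          (fun k => x k ω) (fun k => y k ω) (fun k => z k ω) (fun k => w k ω)) →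
      ∀ K : ℕ,
        Integrable (fun ω => AASCD.objective f h (x (K + 1) ω)) P ∧
        Integrable (fun ω => ‖z (K + 1) ω - xs‖ ^ 2) P ∧
        ((∫ ω, AASCD.objective f h (x (K + 1) ω) ∂P) - AASCD.objective f h xs)
              / AASCD.thetaNC n K ^ 2
            + (n : ℝ) ^ 2 / (2 * γ) * ∫ ω, ‖z (K + 1) ω - xs‖ ^ 2 ∂P
          ≤ (AASCD.objective f h 0 - AASCD.objective f h xs) / AASCD.thetaNC n (-1) ^ 2
            + (n : ℝ) ^ 2 / (2 * γ) * ‖(0 : EuclideanSpace ℝ (Fin n)) - xs‖ ^ 2) ∧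
    (∀ μ : ℝ, 0 < μ → μ ≤ Lc → StrongConvexOn Set.univ μ (AASCD.separable h) →
      2 * γ * Lc + (3 / 4 + 3 / (8 * (n : ℝ))) * γ * Lc
        * (((τ : ℝ) ^ 2 + τ) / n + 2 * τ) ^ 2 ≤ 1 →
      (∀ ω, AASCD.IsRun f h γ (fun _ => AASCD.thetaSC n γ μ) (fun k => idx k ω) (fun k => j k ω)
          (fun k => x k ω) (fun k => y k ω) (fun k => z k ω) (fun k => w k ω)) →
      ∀ K : ℕ,
        Integrable (fun ω => AASCD.objective f h (x (K + 1) ω)) P ∧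
        (∫ ω, AASCD.objective f h (x (K + 1) ω) ∂P) - AASCD.objective f h xs
          ≤ (1 - AASCD.thetaSC n γ μ) ^ (K + 1)
              * (AASCD.objective f h 0 - AASCD.objective f h xs)
            + (1 - AASCD.thetaSC n γ μ) ^ (K + 1)
              * (((n : ℝ) ^ 2 * AASCD.thetaSC n γ μ ^ 2 + n * AASCD.thetaSC n γ μ * μ * γ)
                  / (2 * γ) * ‖(0 : EuclideanSpace ℝ (Fin n)) - xs‖ ^ 2)) := by
  have hn0 : (0 : ℝ) < n := by exact_mod_cast hn
  have hn1 : (1 : ℝ) ≤ n := by exact_mod_cast hn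
  have hL0 := hf_lip.nonneg hn
  rw [AASCD.compensation_eq]
  constructor
  · rintro ⟨hcond, hr⟩ K
    -- The weights are `Λ k = 1 / (θ^(k-1))²`; with them `Λ k * U k` is constant.
    set Λ : ℕ → ℝ := fun k => ((2 * n + k - 1 : ℝ) / 2) ^ 2 with hΛ
    have hpos : ∀ k : ℕ, (0 : ℝ) < 2 * n + k := fun k => by positivity
    have hΛ0 : ∀ k, 0 < Λ k := fun k => by
      have : (0 : ℝ) < 2 * n + k - 1 := by linarith [(Nat.cast_nonneg k : (0 : ℝ) ≤ k)]
      simp only [hΛ]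
      positivity
    have hΛs : ∀ k, Λ (k + 1) = ((2 * n + k : ℝ) / 2) ^ 2 := fun k => by
      simp only [hΛ]
      push_cast
      ring
    have hΛθ : ∀ k : ℕ, Λ (k + 1) * AASCD.thetaNC n k ^ 2 = 1 := fun k => by
      have := (hpos k).ne'
      rw [hΛs, AASCD.thetaNC_eq]
      field_simp
    obtain ⟨h1, h2, h3⟩ := AASCD.expected_potential_le (τ := τ) (L := Lc) (μ := 0) (Λ := Λ)
      (U := fun k => (n : ℝ) ^ 2 / (2 * γ) / Λ k) (ρ := 2 * (1 + 1 / n)) hn hf hf_diff hf_lip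
      (fun i => strongConvexOn_zero.2 (hh i)) le_rfl hγ hxs hs hr
      (fun k => by
        have := hpos k
        rw [AASCD.thetaNC_eq]
        positivity)
      (fun k => by
        rw [AASCD.thetaNC_eq, mul_div_assoc', div_le_one (hpos k)]
        linarith [(Nat.cast_nonneg k : (0 : ℝ) ≤ k)])
      (fun k => by
        rw [AASCD.thetaNC_eq, AASCD.thetaNC_eq]
        refine div_le_div_of_nonneg_left zero_le_two (hpos k) ?_
        push_cast
        linarith)
      hΛ0
      (fun k => by
        rw [div_eq_iff (hΛ0 _).ne']
        linear_combination (-(n : ℝ) ^ 2 / (2 * γ)) * hΛθ k)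
      (fun k => by
        have := (hpos k).ne'
        rw [hΛs, AASCD.thetaNC_eq]
        have he : ((2 * n + k : ℝ) / 2) ^ 2 * (1 - 2 / (2 * n + k))
            = ((2 * n + k : ℝ) / 2) ^ 2 - (2 * n + k) / 2 := by
          field_simp
        rw [he]
        simp only [hΛ]
        linarith)
      (fun k => by
        rw [mul_div_cancel₀ _ (hΛ0 k).ne']
        refine le_of_eq ?_
        linear_combination ((n : ℝ) ^ 2 / (2 * γ)) * hΛθ k)
      (fun i k _ hk => by
        rw [hΛs, hΛs]
        exact AASCD.sq_le_mul_sq_of_delay hn hτ hk)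
      (by
        rw [le_sub_iff_add_le, le_div_iff₀ (by positivity)]
        linarith) (K + 1)
    refine ⟨h1, h2, ?_⟩
    have hdiv : ∀ (a : ℝ), a / AASCD.thetaNC n K ^ 2 = Λ (K + 1) * a := fun a => by
      rw [div_eq_iff (right_ne_zero_of_mul_eq_one (hΛθ K))]
      linear_combination (-a) * hΛθ K
    have hdiv0 : ∀ (a : ℝ), a / AASCD.thetaNC n (-1) ^ 2 = Λ 0 * a := fun a => by
      have : (2 * n - 1 : ℝ) ≠ 0 := by linarith
      simp only [hΛ, AASCD.thetaNC]
      push_cast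
      rw [← sub_eq_add_neg, add_zero]
      field_simp
    rw [hdiv, hdiv0]
    rwa [mul_add, mul_add, ← mul_assoc, ← mul_assoc, mul_div_cancel₀ _ (hΛ0 _).ne',
      mul_div_cancel₀ _ (hΛ0 _).ne'] at h3
  · intro μ hμ hμL hsc hcond hr K
    have hγμ := mul_pos hγ hμ
    have hpow := fun m (hm : m ≤ τ) =>
      AASCD.one_le_mul_one_sub_thetaSC_pow hn hτ hγ hμ hμL hcond hm
    have hθ := AASCD.thetaSC_pos hn hγμ
    have heq := AASCD.thetaSC_equation hn hγμ
    set θ := AASCD.thetaSC n γ μ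
    have hθn : n * θ ≤ 1 / 2 := by
      have h1 : 0 ≤ (3 / 4 + 3 / (8 * (n : ℝ))) * γ * Lc * (2 * AASCD.delayTotal n τ) ^ 2 := by
        positivity
      have h2 : γ * μ ≤ γ * Lc := mul_le_mul_of_nonneg_left hμL hγ.le
      nlinarith [mul_pos hn0 hθ]
    have hθ1 : 0 < 1 - θ := by nlinarith
    set V := ((n : ℝ) ^ 2 * θ ^ 2 + n * θ * μ * γ) / (2 * γ) with hV
    have hV0 : 0 ≤ V := by positivity
    have hVe : V = n ^ 2 * θ ^ 2 / (2 * γ) + n * θ * μ / 2 := by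
      rw [hV]
      field_simp
    -- The equation satisfied by `θ` makes the coefficient of the distance contract by `1 - θ`.
    have hVc : (n : ℝ) ^ 2 * θ ^ 2 / (2 * γ) + (n - 1) * θ * μ / 2 = (1 - θ) * V := by
      rw [hV]
      field_simp
      linear_combination heq
    obtain ⟨h1, -, h3⟩ := AASCD.expected_potential_le (τ := τ) (L := Lc) (μ := μ)
      (Λ := fun k => ((1 - θ) ^ k)⁻¹) (U := fun _ => V) (ρ := 3 / 2 + 3 / (4 * (n : ℝ)))
      hn hf hf_diff hf_lip
      (AASCD.strongConvexOn_of_separable hsc) hμ.le hγ hxs hs hr (fun _ => hθ)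
      (fun _ => by linarith) (fun _ => le_rfl) (fun k => by positivity) (fun _ => hVe)
      (fun k => le_of_eq (by rw [pow_succ]; field_simp))
      (fun k => le_of_eq (by rw [hVc, pow_succ]; field_simp))
      (fun i k hik hk => by
        obtain ⟨m, rfl⟩ := Nat.exists_eq_add_of_le hik
        have h1 := hpow m (by omega)
        rw [show i + m + 1 = (i + 1) + m by ring, pow_add, mul_inv,
          mul_comm _ ((1 - θ) ^ (i + 1))⁻¹]
        refine mul_le_mul_of_nonneg_left ?_ (by positivity)
        rwa [inv_le_iff_one_le_mul₀ (by positivity)])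
      (by
        rw [le_sub_iff_add_le, le_div_iff₀ (by positivity)]
        have he : 3 / (4 * (n : ℝ)) = 2 * (3 / (8 * (n : ℝ))) := by
          field_simp
          norm_num
        rw [he]
        linarith) (K + 1)
    refine ⟨h1, ?_⟩
    rw [pow_zero, inv_one, one_mul, inv_mul_le_iff₀ (by positivity)] at h3
    have h4 : 0 ≤ V * ∫ ω, ‖z (K + 1) ω - xs‖ ^ 2 ∂P :=
      mul_nonneg hV0 (integral_nonneg fun ω => sq_nonneg _)
    linarith
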